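/- Cops and robbers is played on a finite graph $G$ as follows. First $k$ cops choose starting vertices (several may share a vertex), then the robber, seeing them, chooses one. The two sides then alternate turns, the cops first; in a cops' turn each cop stays or moves to an adjacent vertex, and in the robber's turn the robber stays or moves to an adjacent vertex. The cops win if after finitely many turns some cop is on the robber's vertex. The cop number $c(G)$ is the least $k$ for which $k$ cops can force a win. Let $\mathcal N_n$ be the $n\times n$ knight graph: its vertices are the $n^2$ squares of the board, and two squares are adjacent when they differ by $1$ in one coordinate and by $2$ in the other. Let $n\ge 1$. - If $n\le 2$, every connected component of $\mathcal N_n$ has cop number $1$. - If $n\ge 4$, the graph $\mathcal N_n$ is connected. - If $4\le n\le 6$, then $c(\mathcal N_n)=2$. - If $n=3$ or $n\ge 7$, then $c(\mathcal N_n)=3$. Here $c(\mathcal N_n)$ is the cop number of the whole graph, also for the disconnected graph $\mathcal N_3\cong C_8+K_1$. -/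

import Mathlib

/-- The graph `𝒩ₙ` of the knight on the `n × n` board: the vertices are the squares, and two squares
are adjacent when they differ by `1` in one coordinate and by `2` in the other. -/
def knightGraph (n : ℕ) : SimpleGraph (Fin n × Fin n) where
  Adj p q :=
    (|(p.1 : ℤ) - (q.1 : ℤ)| = 1 ∧ |(p.2 : ℤ) - (q.2 : ℤ)| = 2) ∨
    (|(p.1 : ℤ) - (q.1 : ℤ)| = 2 ∧ |(p.2 : ℤ) - (q.2 : ℤ)| = 1)
  symm := ⟨fun p q h => by
    rw [abs_sub_comm (q.1 : ℤ) (p.1 : ℤ), abs_sub_comm (q.2 : ℤ) (p.2 : ℤ)]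
    exact h⟩
  loopless := ⟨fun p h => by simp at h⟩

namespace CopsAndRobbers

variable {V : Type*} (G : SimpleGraph V)

/-- A legal move of one player in one turn: stay, or go to an adjacent vertex. -/
def Move (u v : V) : Prop := u = v ∨ G.Adj u v

/-- `CopsWinFrom G c r`: with the `k` cops at `c 0, …, c (k - 1)`, the robber at `r` and the cops to
move, the cops can force a capture after finitely many turns. Either some cop already stands on the
robber's vertex, or the cops have a joint move (each cop stays or moves along an edge) to `c'` such
that the robber is caught by that move, or every answer of the robber leads to a position from which
the cops win. -/
inductive CopsWinFrom {k : ℕ} : (Fin k → V) → V → Prop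
  | captured (c : Fin k → V) (r : V) (i : Fin k) (h : c i = r) : CopsWinFrom c r
  | capture (c c' : Fin k → V) (r : V) (hc : ∀ i, Move G (c i) (c' i)) (i : Fin k)
      (h : c' i = r) : CopsWinFrom c r
  | step (c c' : Fin k → V) (r : V) (hc : ∀ i, Move G (c i) (c' i))
      (h : ∀ r', Move G r r' → CopsWinFrom c' r') : CopsWinFrom c r

/-- `G` is `k`-cop win: the cops can choose starting vertices such that, wherever the robber then
starts, they win with the cops moving first. -/
def IsCopWin (k : ℕ) : Prop := ∃ c : Fin k → V, ∀ r : V, CopsWinFrom G c r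

/-- The cop number: the least `k` such that `G` is `k`-cop win. (For a finite graph such a `k`
exists, since `|V|` cops win.) -/
noncomputable def copNumber : ℕ := sInf {k : ℕ | IsCopWin G k}

end CopsAndRobbers

/-! Lower bounds. Let S be a set of squares each having at least 2k neighbours in S. A cop who is
not on the robber's square r covers at most two squares of the closed neighbourhood of r in S:
distinct squares have at most two common neighbours, and a cop adjacent to r covers only r and his
own square, the graph being bipartite. So k cops always leave the robber a safe square in S
(`not_isCopWin_of_minDegree`). The 8-cycle of the 3 × 3 board defeats one cop, and 16 squares of the
7 × 7 board defeat two. For n = 3 the isolated centre ties up one further cop.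

Upper bounds for small boards. For n = 4, 5, 6, and for the 8-cycle when n = 3, explicit strategies
of two cops are encoded as lists of bit masks and checked by evaluation
(`twoCopsWinFrom_of_recorded`).

Upper bound for n ≥ 7. Two cops stacked on one square beat a robber who is never allowed to stand
still (`PairWins.stack`). They first make both coordinate differences even. Then they copy or
reflect the robber's step in each coordinate: a large difference shrinks unless he runs away from
them, which the edge stops. Once both differences are at most two, a few local patterns finish; the
essential one is a stack two squares away in the robber's row, which splits so that he is driven to
an edge (`two_two_reply`, `drive_down`, `two_four`). The third cop handles standing still: he steps
towards the robber every turn, so their distance drops at every pause and never grows otherwise.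
Induction on this distance, and for a fixed distance on the derivation of `PairWins`, ends the game
(`copsWinFrom_of_pairWins`). -/

namespace CopsAndRobbers

/-! ### Cops and robbers on a general graph -/

section General

variable {V : Type*} {G : SimpleGraph V}

theorem Move.refl (v : V) : Move G v v := Or.inl rfl

/-- Additional cops do no harm: they may stand still. -/
theorem CopsWinFrom.of_comp {k m : ℕ} {f : Fin k → Fin m} (hf : Function.Injective f)
    {d : Fin k → V} {r : V} (h : CopsWinFrom G d r) :
    ∀ c : Fin m → V, c ∘ f = d → CopsWinFrom G c r := by
  -- The cops in the range of `f` follow the given strategy; `Function.extend` leaves all others in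
  -- place.
  have key : ∀ (c : Fin m → V) (d d' : Fin k → V), c ∘ f = d → (∀ i, Move G (d i) (d' i)) →
      ∀ j, Move G (c j) (Function.extend f d' c j) := by
    rintro c d d' rfl hd j
    by_cases hj : ∃ i, f i = j
    · obtain ⟨i, rfl⟩ := hj
      rw [hf.extend_apply]
      exact hd i
    · rw [Function.extend_apply' _ _ _ hj]
      exact Move.refl _
  induction h with
  | captured d r i h =>
    rintro c rfl
    exact .captured c r (f i) h
  | capture d d' r hd i h =>
    intro c hc
    exact .capture c _ r (key c d d' hc hd) (f i) (by rw [hf.extend_apply, h])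
  | step d d' r hd h ih =>
    intro c hc
    exact .step c _ r (key c d d' hc hd) fun r' hr' =>
      ih r' hr' _ (funext fun i => hf.extend_apply _ _ i)

theorem CopsWinFrom.swap {a b r : V} (h : CopsWinFrom G ![a, b] r) : CopsWinFrom G ![b, a] r :=
  h.of_comp (f := ![1, 0]) (by decide) _ (by funext i; fin_cases i <;> rfl)

/-- A robber who can maintain an invariant that keeps him from being caught is never caught. -/
theorem not_isCopWin_of_invariant {k : ℕ} (Inv : (Fin k → V) → V → Prop)
    (start : ∀ c, ∃ r, Inv c r)
    (step : ∀ c c' r, Inv c r → (∀ i, Move G (c i) (c' i)) →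
      (∀ i, c' i ≠ r) ∧ ∃ r', Move G r r' ∧ Inv c' r') : ¬ IsCopWin G k := by
  rintro ⟨c, hc⟩
  obtain ⟨r, hr⟩ := start c
  have key : ∀ (c : Fin k → V) (r : V), CopsWinFrom G c r → ¬ Inv c r := by
    intro c r h
    induction h with
    -- Here the invariant is tested against the turn in which every cop passes.
    | captured c r i h => exact fun hI => (step c c r hI fun i => Move.refl _).1 i h
    | capture c c' r hc i h => exact fun hI => (step c c' r hI hc).1 i h
    | step c c' r hc h ih =>
      intro hI
      obtain ⟨r', hr', hI'⟩ := (step c c' r hI hc).2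
      exact ih r' hr' hI'
  exact key c r (hc r) hr

/-- If from every vertex of `S` not occupied by a cop the robber can reach a vertex of `S` that no
cop attacks, then he escapes forever. -/
theorem not_isCopWin_of_safe_set {k : ℕ} (S : Set V) (hne : ∀ c : Fin k → V, ∃ r ∈ S, ∀ i, c i ≠ r)
    (h : ∀ (c : Fin k → V), ∀ r ∈ S, (∀ i, c i ≠ r) →
      ∃ r' ∈ S, Move G r r' ∧ ∀ i, ¬ Move G (c i) r') : ¬ IsCopWin G k := by
  refine not_isCopWin_of_invariant (fun c r => r ∈ S ∧ ∀ i, ¬ Move G (c i) r) ?_ ?_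
  · intro c
    -- The robber starts where he would flee to from an unoccupied square of `S`.
    obtain ⟨r, hr, hc⟩ := hne c
    obtain ⟨r', h1, -, h2⟩ := h c r hr hc
    exact ⟨r', h1, h2⟩
  · rintro c c' r ⟨hr, hc⟩ hm
    have hne : ∀ i, c' i ≠ r := fun i hi => hc i (hi ▸ hm i)
    obtain ⟨r', h1, h2, h3⟩ := h c' r hr hne
    exact ⟨hne, r', h2, h1, h3⟩

theorem copNumber_eq {k : ℕ} (h : IsCopWin G k) (h' : ∀ j < k, ¬ IsCopWin G j) :
    copNumber G = k :=
  le_antisymm (Nat.sInf_le h) (le_csInf ⟨k, h⟩ fun j hj => not_lt.1 fun hlt => h' j hlt hj)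

end General

end CopsAndRobbers

/-! ### Knight moves in coordinates and the lower bounds -/

open CopsAndRobbers

/-- Two squares, given by their coordinates, are equal or a knight's move apart. -/
def KnightNear (p q : ℕ × ℕ) : Prop :=
  p = q ∨ ((p.1 + 1 = q.1 ∨ q.1 + 1 = p.1) ∧ (p.2 + 2 = q.2 ∨ q.2 + 2 = p.2)) ∨
    ((p.1 + 2 = q.1 ∨ q.1 + 2 = p.1) ∧ (p.2 + 1 = q.2 ∨ q.2 + 1 = p.2))

instance : DecidableRel KnightNear := fun p q => by unfold KnightNear; infer_instance

/-- The coordinates of a square. -/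
def squareVal {n : ℕ} (p : Fin n × Fin n) : ℕ × ℕ := (p.1, p.2)

theorem squareVal_injective {n : ℕ} : Function.Injective (squareVal (n := n)) := by
  rintro ⟨a, b⟩ ⟨c, d⟩ h
  simp only [squareVal, Prod.mk.injEq] at h
  exact Prod.ext (Fin.ext h.1) (Fin.ext h.2)

theorem abs_natCast_sub_eq_one (a b : ℕ) : |(a : ℤ) - b| = 1 ↔ a + 1 = b ∨ b + 1 = a := by
  rw [abs_eq (by norm_num)]; omega

theorem abs_natCast_sub_eq_two (a b : ℕ) : |(a : ℤ) - b| = 2 ↔ a + 2 = b ∨ b + 2 = a := by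
  rw [abs_eq (by norm_num)]; omega

theorem move_iff_knightNear {n : ℕ} (p q : Fin n × Fin n) :
    Move (knightGraph n) p q ↔ KnightNear (squareVal p) (squareVal q) := by
  simp only [Move, knightGraph, KnightNear, abs_natCast_sub_eq_one, abs_natCast_sub_eq_two,
    squareVal_injective.eq_iff]
  simp only [squareVal]

/-- If every cop attacks at most two of the squares of `A` except those that attack none, some
square is left unattacked. -/
theorem exists_not_knightNear {k : ℕ} (A : Finset (ℕ × ℕ)) (T : Finset (Fin k))
    (c : Fin k → ℕ × ℕ) (hT : ∀ i ∈ T, (A.filter (KnightNear (c i))).card ≤ 2)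
    (hT' : ∀ i ∉ T, ∀ a ∈ A, ¬ KnightNear (c i) a) (hA : 2 * T.card < A.card) :
    ∃ a ∈ A, ∀ i, ¬ KnightNear (c i) a := by
  by_contra! hcon
  have hsub : A ⊆ T.biUnion fun i => A.filter (KnightNear (c i)) := by
    intro a ha
    obtain ⟨i, hi⟩ := hcon a ha
    have : i ∈ T := by
      by_contra hiT
      exact hT' i hiT a ha hi
    exact Finset.mem_biUnion.2 ⟨i, this, Finset.mem_filter.2 ⟨ha, hi⟩⟩
  have h1 := Finset.card_le_card hsub
  have h2 := Finset.card_biUnion_le_card_mul T _ 2 hT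
  omega

/-- A set of squares of the `7 × 7` board in which every square has at least four neighbours. -/
def coreSquares : Finset (ℕ × ℕ) :=
  {(0, 3), (1, 1), (1, 5), (2, 2), (2, 3), (2, 4), (3, 0), (3, 2), (3, 4), (3, 6), (4, 2), (4, 3),
    (4, 4), (5, 1), (5, 5), (6, 3)}

/-- The squares of the `3 × 3` board other than its centre. -/
def ringSquares : Finset (ℕ × ℕ) :=
  {(0, 0), (0, 1), (0, 2), (1, 0), (1, 2), (2, 0), (2, 1), (2, 2)}

/-- Makes the covering bound a finite check: a knight with a coordinate of at least 9 attacks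
nothing with coordinates below 7. -/
theorem card_filter_knightNear_le {S : Finset (ℕ × ℕ)} (hS : ∀ a ∈ S, a.1 < 7 ∧ a.2 < 7)
    (h : ∀ r ∈ S, ∀ x < 9, ∀ y < 9, (x, y) ≠ r →
      ((S.filter (KnightNear r)).filter (KnightNear (x, y))).card ≤ 2)
    {r : ℕ × ℕ} (hr : r ∈ S) {c : ℕ × ℕ} (hc : c ≠ r) :
    ((S.filter (KnightNear r)).filter (KnightNear c)).card ≤ 2 := by
  by_cases hlt : c.1 < 9 ∧ c.2 < 9
  · exact h r hr c.1 hlt.1 c.2 hlt.2 hc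
  · rw [Finset.filter_eq_empty_iff.2, Finset.card_empty]
    · exact Nat.zero_le _
    · intro a ha hca
      have := hS a (Finset.mem_filter.1 ha).1
      obtain ⟨a1, a2⟩ := a
      obtain ⟨c1, c2⟩ := c
      simp only [KnightNear, Prod.mk.injEq] at *
      omega

set_option maxRecDepth 100000 in
theorem coreSquares_card_filter {r : ℕ × ℕ} (hr : r ∈ coreSquares) {c : ℕ × ℕ} (hc : c ≠ r) :
    ((coreSquares.filter (KnightNear r)).filter (KnightNear c)).card ≤ 2 :=
  card_filter_knightNear_le (by decide +kernel) (by decide +kernel) hr hc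

theorem ringSquares_card_filter {r : ℕ × ℕ} (hr : r ∈ ringSquares) {c : ℕ × ℕ} (hc : c ≠ r) :
    ((ringSquares.filter (KnightNear r)).filter (KnightNear c)).card ≤ 2 :=
  card_filter_knightNear_le (by decide +kernel) (by decide +kernel) hr hc

theorem exists_square {n : ℕ} {S : Finset (ℕ × ℕ)} (hS : ∀ a ∈ S, a.1 < n ∧ a.2 < n) {a : ℕ × ℕ}
    (ha : a ∈ S) : ∃ p : Fin n × Fin n, squareVal p = a :=
  ⟨(⟨a.1, (hS a ha).1⟩, ⟨a.2, (hS a ha).2⟩), rfl⟩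

theorem exists_mem_forall_ne {k n : ℕ} {S : Finset (ℕ × ℕ)} (hS : ∀ a ∈ S, a.1 < n ∧ a.2 < n)
    (hk : k < S.card) (c : Fin k → Fin n × Fin n) :
    ∃ r : Fin n × Fin n, squareVal r ∈ S ∧ ∀ i, c i ≠ r := by
  obtain ⟨a, ha, hac⟩ : ∃ a ∈ S, a ∉ Finset.univ.image fun i => squareVal (c i) := by
    by_contra! hcon
    have h1 := Finset.card_le_card (show S ⊆ _ from hcon)
    have h2 := Finset.card_image_le (s := Finset.univ) (f := fun i => squareVal (c i))
    simp only [Finset.card_univ, Fintype.card_fin] at h2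
    omega
  obtain ⟨r, rfl⟩ := exists_square hS ha
  refine ⟨r, ha, fun i hi => hac (Finset.mem_image.2 ⟨i, Finset.mem_univ _, by rw [hi]⟩)⟩

/-- A set of squares in which every square has at least `2 k` neighbours is safe against `k`
cops. -/
theorem not_isCopWin_of_minDegree {k n : ℕ} {S : Finset (ℕ × ℕ)}
    (hS : ∀ a ∈ S, a.1 < n ∧ a.2 < n) (hk : k < S.card)
    (hdeg : ∀ r ∈ S, 2 * k < (S.filter (KnightNear r)).card)
    (hcov : ∀ r ∈ S, ∀ c, c ≠ r → ((S.filter (KnightNear r)).filter (KnightNear c)).card ≤ 2) :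
    ¬ IsCopWin (knightGraph n) k := by
  refine not_isCopWin_of_safe_set {r | squareVal r ∈ S} (exists_mem_forall_ne hS hk) ?_
  intro c r hr hc
  -- The closed neighbourhood of `r` in `S` has more than `2 * k` squares, `r` included, and each
  -- cop covers at most two of them.
  obtain ⟨a, ha, hac⟩ := exists_not_knightNear (S.filter (KnightNear (squareVal r))) Finset.univ
    (fun i => squareVal (c i))
    (fun i _ => hcov _ hr _ fun h => hc i (squareVal_injective h)) (by simp)
    (by simpa using hdeg _ hr)
  rw [Finset.mem_filter] at ha
  obtain ⟨r', rfl⟩ := exists_square hS ha.1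
  exact ⟨r', ha.1, (move_iff_knightNear _ _).2 ha.2,
    fun i h => hac i ((move_iff_knightNear _ _).1 h)⟩

/-- The robber stays within a 7 × 7 corner of the board; the cops may use the whole board, as the
covering bound holds for every cop square other than the robber's. -/
theorem not_isCopWin_knightGraph_of_le_two {k n : ℕ} (hk : k ≤ 2) (hn : 7 ≤ n) :
    ¬ IsCopWin (knightGraph n) k := by
  have hS : ∀ a ∈ coreSquares, a.1 < 7 ∧ a.2 < 7 := by decide
  have hdeg : ∀ r ∈ coreSquares, 4 < (coreSquares.filter (KnightNear r)).card := by
    decide +kernel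
  have hcard : coreSquares.card = 16 := by decide
  refine not_isCopWin_of_minDegree (S := coreSquares)
    (fun a ha => ⟨(hS a ha).1.trans_le hn, (hS a ha).2.trans_le hn⟩) (by omega)
    (fun r hr => ?_) fun r hr c hc => coreSquares_card_filter hr hc
  have := hdeg r hr
  omega

theorem not_isCopWin_knightGraph_of_le_one {k n : ℕ} (hk : k ≤ 1) (hn : 3 ≤ n) :
    ¬ IsCopWin (knightGraph n) k := by
  have hS : ∀ a ∈ ringSquares, a.1 < 3 ∧ a.2 < 3 := by decide
  have hdeg : ∀ r ∈ ringSquares, 2 < (ringSquares.filter (KnightNear r)).card := by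
    decide +kernel
  have hcard : ringSquares.card = 8 := by decide
  refine not_isCopWin_of_minDegree (S := ringSquares)
    (fun a ha => ⟨(hS a ha).1.trans_le hn, (hS a ha).2.trans_le hn⟩) (by omega)
    (fun r hr => ?_) fun r hr c hc => ringSquares_card_filter hr hc
  have := hdeg r hr
  omega

theorem knightNear_center {n : ℕ} (hn : n = 3) {p q : Fin n × Fin n} (hp : squareVal p = (1, 1))
    (h : Move (knightGraph n) p q) : q = p := by
  subst hn
  rw [move_iff_knightNear, hp] at h
  apply squareVal_injective
  rw [hp]
  obtain ⟨⟨a, ha⟩, ⟨b, hb⟩⟩ := q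
  simp only [KnightNear, squareVal, Prod.mk.injEq] at *
  omega

/-- If no cop starts in the centre, the robber sits there and is unreachable. Otherwise the cop in
the centre can never leave it, and the other one alone cannot win on the 8-cycle. -/
theorem not_isCopWin_knightGraph_three_two : ¬ IsCopWin (knightGraph 3) 2 := by
  have hS : ∀ a ∈ ringSquares, a.1 < 3 ∧ a.2 < 3 := by decide
  let o : Fin 3 × Fin 3 := (1, 1)
  have ho : squareVal o = (1, 1) := rfl
  have hring : ∀ a ∈ ringSquares, ¬ KnightNear (1, 1) a := by decide
  have hdeg : ∀ r ∈ ringSquares, 2 < (ringSquares.filter (KnightNear r)).card := by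
    decide +kernel
  have escape : ∀ (c : Fin 2 → Fin 3 × Fin 3) (r : Fin 3 × Fin 3), (∃ i, c i = o) →
      squareVal r ∈ ringSquares → (∀ i, c i ≠ r) → ∃ r', squareVal r' ∈ ringSquares ∧
        Move (knightGraph 3) r r' ∧ ∀ i, ¬ Move (knightGraph 3) (c i) r' := by
    rintro c r ⟨j, hj⟩ hr hc
    -- The cop in the centre attacks no square of the ring, so only the other one is counted: he
    -- covers at most two of at least three squares.
    obtain ⟨a, ha, hac⟩ := exists_not_knightNear (ringSquares.filter (KnightNear (squareVal r)))
      (Finset.univ.erase j) (fun i => squareVal (c i))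
      (fun i _ => ringSquares_card_filter hr fun h => hc i (squareVal_injective h))
      (fun i hi a ha => by
        have hij : i = j := by simpa using hi
        rw [hij, hj]
        exact hring a (Finset.mem_filter.1 ha).1)
      (by simpa using hdeg _ hr)
    rw [Finset.mem_filter] at ha
    obtain ⟨r', rfl⟩ := exists_square hS ha.1
    exact ⟨r', ha.1, (move_iff_knightNear _ _).2 ha.2,
      fun i h => hac i ((move_iff_knightNear _ _).1 h)⟩
  refine not_isCopWin_of_invariant (fun c r => (r = o ∧ ∀ i, c i ≠ o) ∨
    ((∃ i, c i = o) ∧ squareVal r ∈ ringSquares ∧ ∀ i, ¬ Move (knightGraph 3) (c i) r)) ?_ ?_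
  · intro c
    by_cases h : ∃ i, c i = o
    · obtain ⟨r, hr, hc⟩ := exists_mem_forall_ne hS (by decide) c
      obtain ⟨r', h1, -, h2⟩ := escape c r h hr hc
      exact ⟨r', Or.inr ⟨h, h1, h2⟩⟩
    · push Not at h
      exact ⟨o, Or.inl ⟨rfl, h⟩⟩
  · rintro c c' r (⟨rfl, hc⟩ | ⟨⟨j, hj⟩, hr, hc⟩) hm
    · have h' : ∀ i, c' i ≠ o := fun i hi => by
        have hmi := hm i
        rw [hi] at hmi
        refine hc i (knightNear_center rfl ho ?_)
        rcases hmi with h | h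
        · exact Or.inl h.symm
        · exact Or.inr h.symm
      exact ⟨h', o, Move.refl _, Or.inl ⟨rfl, h'⟩⟩
    · have hne : ∀ i, c' i ≠ r := fun i hi => hc i (hi ▸ hm i)
      have hj' : c' j = o := by
        have := hm j
        rw [hj] at this
        exact knightNear_center rfl ho this
      obtain ⟨r', h1, h2, h3⟩ := escape c' r ⟨j, hj'⟩ hr hne
      exact ⟨hne, r', h2, Or.inr ⟨⟨j, hj'⟩, h1, h3⟩⟩

/-! ### Checkable strategies for two cops -/

/-- The square of the `n × n` board with the number `q`, the squares being numbered row by row. -/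
def numberedSquare (n q : ℕ) : ℕ × ℕ := (q / n, q % n)

/-- `M` lists, as bit masks, the sets of squares that a knight attacks or occupies. -/
def IsAttackTable (n : ℕ) (M : List ℕ) : Prop :=
  M.length = n * n ∧ ∀ p < n * n, M.getD p 0 < 2 ^ (n * n) ∧ ∀ q < n * n,
    (M.getD p 0).testBit q ↔ KnightNear (numberedSquare n p) (numberedSquare n q)

instance (n : ℕ) (M : List ℕ) : Decidable (IsAttackTable n M) := by
  unfold IsAttackTable; infer_instance

/-- The union of the masks recorded in `L` for the cops' position `P`. In an entry `(P, Q, m)`,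
the numbers `P` and `Q` encode positions `100 * a + b` of two cops, and `m` is a set of positions
of the robber. -/
def recordedMask (P : ℕ) : List (ℕ × ℕ × ℕ) → ℕ
  | [] => 0
  | e :: L => if e.1 = P then e.2.2 ||| recordedMask P L else recordedMask P L

/-- The recorded robber positions, and those where he can be caught at once. -/
def winningMask (M : List ℕ) (L : List (ℕ × ℕ × ℕ)) (P : ℕ) : ℕ :=
  recordedMask P L ||| (M.getD (P / 100) 0 ||| M.getD (P % 100) 0)

/-- Both cops can move so that the position `P` becomes `Q`, up to exchanging the cops. -/
def CopsCanMove (M : List ℕ) (P Q : ℕ) : Prop :=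
  ((M.getD (P / 100) 0).testBit (Q / 100) ∧ (M.getD (P % 100) 0).testBit (Q % 100)) ∨
    ((M.getD (P / 100) 0).testBit (Q % 100) ∧ (M.getD (P % 100) 0).testBit (Q / 100))

instance (M : List ℕ) (P Q : ℕ) : Decidable (CopsCanMove M P Q) := by
  unfold CopsCanMove; infer_instance

/-- From every robber position in `m`, the robber cannot leave the set `g`; here `ms` lists the
attack masks of the squares from number `i` on. -/
def Confines (g m : ℕ) : List ℕ → ℕ → Prop
  | [], _ => True
  | a :: ms, i => (m.testBit i → a &&& g = a) ∧ Confines g m ms (i + 1)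

instance decidableConfines (g m : ℕ) : ∀ (ms : List ℕ) (i : ℕ), Decidable (Confines g m ms i)
  | [], _ => isTrue trivial
  | a :: ms, i =>
    haveI := decidableConfines g m ms (i + 1)
    inferInstanceAs (Decidable ((m.testBit i → a &&& g = a) ∧ Confines g m ms (i + 1)))

/-- A strategy for two cops: each entry is justified by the entries after it. -/
def IsStrategy (M : List ℕ) : List (ℕ × ℕ × ℕ) → Prop
  | [] => True
  | (P, Q, m) :: L => m < 2 ^ M.length ∧ CopsCanMove M P Q ∧
      Confines (winningMask M L Q) m M 0 ∧ IsStrategy M L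

instance decidableIsStrategy (M : List ℕ) :
    ∀ L : List (ℕ × ℕ × ℕ), Decidable (IsStrategy M L)
  | [] => isTrue trivial
  | (P, Q, m) :: L =>
    haveI := decidableIsStrategy M L
    inferInstanceAs (Decidable (m < 2 ^ M.length ∧ CopsCanMove M P Q ∧
      Confines (winningMask M L Q) m M 0 ∧ IsStrategy M L))

theorem Confines.and_eq {g m : ℕ} : ∀ {ms : List ℕ} {i : ℕ}, Confines g m ms i →
    ∀ {j : ℕ}, j < ms.length → m.testBit (i + j) → ms.getD j 0 &&& g = ms.getD j 0
  | a :: ms, i, h, 0, _, hm => h.1 hm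
  | a :: ms, i, h, j + 1, hj, hm => by
    simpa using h.2.and_eq (j := j) (by simpa using hj) (by rwa [Nat.add_right_comm, Nat.add_assoc])

theorem IsAttackTable.testBit {n : ℕ} {M : List ℕ} (hM : IsAttackTable n M) {p q : ℕ}
    (h : (M.getD p 0).testBit q) :
    p < n * n ∧ q < n * n ∧ KnightNear (numberedSquare n p) (numberedSquare n q) := by
  have hp : p < n * n := by
    by_contra hp
    rw [List.getD_eq_default _ _ (by rw [hM.1]; omega)] at h
    simp at h
  have hq : q < n * n := by
    by_contra hq
    rw [Nat.testBit_lt_two_pow ((hM.2 p hp).1.trans_le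
      (Nat.pow_le_pow_right two_pos (not_lt.1 hq)))] at h
    simp at h
  exact ⟨hp, hq, ((hM.2 p hp).2 q hq).1 h⟩

theorem exists_numberedSquare {n q : ℕ} (hq : q < n * n) :
    ∃ p : Fin n × Fin n, squareVal p = numberedSquare n q :=
  have hn : 0 < n := Nat.pos_of_ne_zero (by rintro rfl; simp at hq)
  ⟨(⟨q / n, Nat.div_lt_of_lt_mul hq⟩, ⟨q % n, Nat.mod_lt _ hn⟩), rfl⟩

theorem exists_number {n : ℕ} (p : Fin n × Fin n) :
    ∃ q < n * n, squareVal p = numberedSquare n q := by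
  obtain ⟨⟨a, ha⟩, ⟨b, hb⟩⟩ := p
  have hn : 0 < n := by omega
  refine ⟨n * a + b, by nlinarith, ?_⟩
  simp only [squareVal, numberedSquare, Prod.mk.injEq]
  exact ⟨by rw [Nat.mul_add_div hn, Nat.div_eq_of_lt hb, add_zero],
    by rw [Nat.mul_add_mod, Nat.mod_eq_of_lt hb]⟩

/-- The two cops win from the encoded position `P` against a robber on the square number `r`. -/
def TwoCopsWinFrom (n P r : ℕ) : Prop :=
  ∀ p q s : Fin n × Fin n, squareVal p = numberedSquare n (P / 100) →
    squareVal q = numberedSquare n (P % 100) → squareVal s = numberedSquare n r →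
    CopsWinFrom (knightGraph n) ![p, q] s

theorem twoCopsWinFrom_of_attack {n : ℕ} {M : List ℕ} (hM : IsAttackTable n M) {P r : ℕ}
    (h : (M.getD (P / 100) 0 ||| M.getD (P % 100) 0).testBit r) : TwoCopsWinFrom n P r := by
  intro p q s hp hq hs
  rw [Nat.testBit_or, Bool.or_eq_true] at h
  rcases h with h | h
  · have := (hM.testBit h).2.2
    rw [← hp, ← hs, ← move_iff_knightNear] at this
    exact .capture _ ![s, q] s (fun i => by fin_cases i; exacts [this, Move.refl _]) 0 rfl
  · have := (hM.testBit h).2.2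
    rw [← hq, ← hs, ← move_iff_knightNear] at this
    exact .capture _ ![p, s] s (fun i => by fin_cases i; exacts [Move.refl _, this]) 1 rfl

theorem twoCopsWinFrom_of_recorded {n : ℕ} {M : List ℕ} (hM : IsAttackTable n M) :
    ∀ {L : List (ℕ × ℕ × ℕ)}, IsStrategy M L → ∀ {P r : ℕ}, (recordedMask P L).testBit r →
      TwoCopsWinFrom n P r
  | [], _, P, r, h => by simp [recordedMask] at h
  | (P', Q, m) :: L, ⟨hm, hmove, hconf, hL⟩, P, r, h => by
    have ih {P r : ℕ} := twoCopsWinFrom_of_recorded hM hL (P := P) (r := r)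
    by_cases hP : P' = P
    swap
    · rw [recordedMask, if_neg hP] at h
      exact ih h
    subst hP
    rw [recordedMask, if_pos rfl, Nat.testBit_or, Bool.or_eq_true] at h
    rcases h with h | h
    swap
    · exact ih h
    -- The size bound on `m` ensures that its bits are numbers of squares of the board.
    have hr : r < M.length := by
      by_contra hr
      rw [Nat.testBit_lt_two_pow (hm.trans_le (Nat.pow_le_pow_right two_pos (not_lt.1 hr)))] at h
      simp at h
    have hand := hconf.and_eq hr (by simpa using h)
    have step : ∀ p q p' q' s : Fin n × Fin n, squareVal p' = numberedSquare n (Q / 100) →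
        squareVal q' = numberedSquare n (Q % 100) → squareVal s = numberedSquare n r →
        Move (knightGraph n) p p' → Move (knightGraph n) q q' →
        CopsWinFrom (knightGraph n) ![p, q] s := by
      intro p q p' q' s hp' hq' hs h1 h2
      refine .step _ ![p', q'] s (fun i => by fin_cases i; exacts [h1, h2]) fun s' hs' => ?_
      obtain ⟨t, ht, hst⟩ := exists_number s'
      have hrt : (M.getD r 0).testBit t :=
        ((hM.2 r (hM.1 ▸ hr)).2 t ht).2 (by rw [← hs, ← hst, ← move_iff_knightNear]; exact hs')
      -- `hand` says that the closed neighbourhood of `r` lies in the winning mask of `Q`; so the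
      -- robber's answer `t` is recorded in a later entry or can be captured at once.
      rw [← hand, Nat.testBit_and, Bool.and_eq_true, winningMask, Nat.testBit_or,
        Bool.or_eq_true] at hrt
      rcases hrt.2 with h | h
      · exact ih h p' q' s' hp' hq' hst
      · exact twoCopsWinFrom_of_attack hM h p' q' s' hp' hq' hst
    intro p q s hp hq hs
    rcases hmove with ⟨h1, h2⟩ | ⟨h1, h2⟩
    · obtain ⟨-, b1, k1⟩ := hM.testBit h1
      obtain ⟨-, b2, k2⟩ := hM.testBit h2
      obtain ⟨p', hp'⟩ := exists_numberedSquare b1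
      obtain ⟨q', hq'⟩ := exists_numberedSquare b2
      rw [← hp, ← hp', ← move_iff_knightNear] at k1
      rw [← hq, ← hq', ← move_iff_knightNear] at k2
      exact step p q p' q' s hp' hq' hs k1 k2
    · obtain ⟨-, b1, k1⟩ := hM.testBit h1
      obtain ⟨-, b2, k2⟩ := hM.testBit h2
      obtain ⟨q', hq'⟩ := exists_numberedSquare b1
      obtain ⟨p', hp'⟩ := exists_numberedSquare b2
      rw [← hp, ← hq', ← move_iff_knightNear] at k1
      rw [← hq, ← hp', ← move_iff_knightNear] at k2
      -- The move realises `Q` with the two cops exchanged.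
      exact (step q p p' q' s hp' hq' hs k2 k1).swap

theorem twoCopsWinFrom_of_winningMask {n : ℕ} {M : List ℕ} (hM : IsAttackTable n M)
    {L : List (ℕ × ℕ × ℕ)} (hL : IsStrategy M L) {P r : ℕ}
    (h : (winningMask M L P).testBit r) : TwoCopsWinFrom n P r := by
  rw [winningMask, Nat.testBit_or, Bool.or_eq_true] at h
  rcases h with h | h
  · exact twoCopsWinFrom_of_recorded hM hL h
  · exact twoCopsWinFrom_of_attack hM h

theorem isCopWin_two_of_strategy {n : ℕ} {M : List ℕ} (hM : IsAttackTable n M)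
    {L : List (ℕ × ℕ × ℕ)} (hL : IsStrategy M L) (P : ℕ) (hP : P / 100 < n * n)
    (hP' : P % 100 < n * n) (h : ∀ r < n * n, (winningMask M L P).testBit r) :
    IsCopWin (knightGraph n) 2 := by
  obtain ⟨p, hp⟩ := exists_numberedSquare hP
  obtain ⟨q, hq⟩ := exists_numberedSquare hP'
  refine ⟨![p, q], fun s => ?_⟩
  obtain ⟨r, hr, hs⟩ := exists_number s
  exact twoCopsWinFrom_of_winningMask hM hL (h r hr) p q s hp hq hs

/-! ### Strategies on the boards of side 3 to 6 -/

/-- The attack masks of the `3 × 3` board. -/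
def attackTableThree : List ℕ :=
  [161, 322, 140, 268, 16, 97, 98, 133, 266]

/-- A strategy for two cops on the `3 × 3` board. -/
def copStrategyThree : List (ℕ × ℕ × ℕ) :=
  [(607, 102, 264)]

theorem isAttackTable_three : IsAttackTable 3 attackTableThree := by decide +kernel

theorem isStrategy_three : IsStrategy attackTableThree copStrategyThree := by decide +kernel

/-- One cop guards the centre, number 4. The other two leave only the squares 3 and 8 of the 8-cycle
unattacked, and then close in from both sides. -/
theorem isCopWin_three_knightGraph_three : IsCopWin (knightGraph 3) 3 := by
  refine ⟨![(1, 1), (2, 0), (2, 1)], fun s => ?_⟩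
  by_cases hs : s = (1, 1)
  · exact .captured _ _ 0 hs.symm
  obtain ⟨r, hr, hsr⟩ := exists_number s
  have hr4 : r ≠ 4 := by
    rintro rfl
    exact hs (squareVal_injective hsr)
  have key : ∀ r < 3 * 3, r ≠ 4 →
      (winningMask attackTableThree copStrategyThree 607).testBit r := by decide +kernel
  exact (twoCopsWinFrom_of_winningMask isAttackTable_three isStrategy_three (key r hr hr4)
    (2, 0) (2, 1) s rfl rfl hsr).of_comp (f := ![1, 2]) (by decide) _
    (by funext i; fin_cases i <;> rfl)

/-- The attack masks of the `4 × 4` board. -/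
def attackTableFour : List ℕ :=
  [577, 1410, 2580, 1064, 9236, 22568, 41281, 17026, 16706, 33413, 5146, 10276, 5152, 10320,
    16800, 33344]

/-- A strategy for two cops on the `4 × 4` board. -/
def copStrategyFour : List (ℕ × ℕ × ℕ) :=
  [(711, 713, 33089), (711, 111, 5144), (713, 607, 33025), (111, 1011, 4120)]

theorem isAttackTable_four : IsAttackTable 4 attackTableFour := by decide +kernel

theorem isStrategy_four : IsStrategy attackTableFour copStrategyFour := by decide +kernel

theorem isCopWin_two_knightGraph_four : IsCopWin (knightGraph 4) 2 :=
  isCopWin_two_of_strategy isAttackTable_four isStrategy_four 711 (by norm_num) (by norm_num)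
    (by decide +kernel)

/-- The attack masks of the `5 × 5` board. -/
def attackTableFive : List ℕ :=
  [2177, 5378, 10788, 20552, 8336, 69668, 172104, 345233, 657666, 266756, 2229378, 5507333,
    11047466, 21045332, 8536200, 4231232, 8462496, 17974592, 2361984, 4722944, 1181696, 2364416,
    4761600, 8474624, 16916480]

/-- A strategy for two cops on the `5 × 5` board. -/
def copStrategyFive : List (ℕ × ℕ × ℕ) :=
  [(1013, 113, 561184), (1013, 116, 8388608), (1013, 106, 8), (1013, 102, 2560),
    (113, 116, 8388608), (113, 106, 8), (113, 102, 2099712), (1013, 1722, 1048832),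
    (1013, 607, 16384), (116, 1023, 16384), (106, 310, 16384), (102, 1011, 1310721),
    (102, 813, 20971520), (1722, 1019, 2), (1023, 1217, 8), (1013, 207, 262145), (1011, 221, 512),
    (813, 619, 32768), (607, 316, 8388608), (310, 712, 8388608), (207, 910, 2097152),
    (113, 1213, 32800), (113, 122, 524288), (102, 910, 2097152)]

theorem isAttackTable_five : IsAttackTable 5 attackTableFive := by decide +kernel

theorem isStrategy_five : IsStrategy attackTableFive copStrategyFive := by decide +kernel

theorem isCopWin_two_knightGraph_five : IsCopWin (knightGraph 5) 2 :=
  isCopWin_two_of_strategy isAttackTable_five isStrategy_five 1013 (by norm_num) (by norm_num)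
    (by decide +kernel)

/-- The attack masks of the `6 × 6` board. -/
def attackTableSix : List ℕ :=
  [8449, 20994, 42052, 84104, 164112, 66080, 540740, 1343624, 2691345, 5382690, 10503172,
    4229128, 34607362, 85991941, 172246090, 344492180, 672203048, 270664208, 2214871168,
    5503484224, 11023749760, 22047499520, 43020995072, 17322509312, 4312801280, 8625606656,
    18325217280, 36650434560, 4564615168, 9128968192, 1141374976, 2283012096, 4582801408,
    9165602816, 17257463808, 34498150400]

/-- A strategy for two cops on the `6 × 6` board. -/
def copStrategySix : List (ℕ × ℕ × ℕ) :=
  [(2528, 2021, 553721856), (2528, 1521, 67108885), (2528, 1420, 134217770),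
    (2528, 1415, 13109248), (2528, 1733, 512), (2528, 1525, 18253874240),
    (2528, 1428, 36507222144), (2528, 1232, 256), (2021, 1016, 134217728), (2021, 713, 67108864),
    (1521, 2526, 4194304), (1420, 2728, 524288), (1415, 2228, 512), (1415, 1925, 256),
    (2728, 1632, 256), (2526, 1333, 512), (2228, 1726, 8192), (2021, 1020, 40), (2021, 721, 5),
    (1925, 1227, 65536), (1733, 2122, 8193), (1525, 225, 1024), (1521, 1525, 262144),
    (1428, 1828, 128), (1420, 714, 8388608), (1415, 1525, 4294967296), (1415, 1428, 8589934592),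
    (1232, 1920, 65568), (1016, 823, 524288), (713, 918, 4194304), (2122, 1026, 4),
    (1920, 727, 8), (1828, 1420, 42949673002), (1726, 1521, 4294967301), (1632, 2021, 135168),
    (1525, 1521, 21474836480), (1525, 1428, 2147483648), (1525, 721, 16777217),
    (1428, 2025, 536870912), (1333, 2021, 135168), (1227, 1420, 8589934632), (1020, 1420, 42),
    (1020, 714, 34359740416), (918, 1420, 42949672968), (823, 1521, 5368709124), (721, 1525, 64),
    (721, 1521, 1073741845), (714, 1415, 35441870848), (714, 1018, 17179869184),
    (225, 1415, 35442132992), (2728, 1415, 1074006080), (2526, 1415, 34368129088),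
    (2228, 1420, 2147483690), (2122, 932, 16777216), (2122, 826, 1073741825),
    (2025, 1625, 536870912), (2021, 925, 2), (2021, 828, 16), (1925, 1521, 17179869205),
    (1920, 833, 536870912), (1920, 809, 33), (1733, 929, 32), (1733, 925, 2),
    (1726, 1328, 16777216), (1632, 828, 16), (1632, 821, 1), (1525, 1415, 35433742400),
    (1521, 1328, 16777216), (1521, 1019, 64), (1521, 826, 1073741825), (1428, 1420, 45097156640),
    (1420, 1625, 536870912), (1420, 927, 34359738400), (1420, 722, 2048),
    (1415, 2627, 35433480192), (1415, 1026, 17179869184), (1415, 727, 2147483648),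
    (1333, 929, 32), (1333, 925, 2), (1232, 828, 16), (1232, 824, 1), (1227, 1625, 536870912),
    (1026, 1415, 2112), (1018, 1026, 17179869184), (1016, 1427, 34359738368),
    (1016, 1420, 2147483650), (918, 722, 2048), (823, 1019, 64), (727, 1415, 2112),
    (721, 2021, 16777216), (713, 1526, 1073741824), (713, 1521, 17179869200)]

theorem isAttackTable_six : IsAttackTable 6 attackTableSix := by decide +kernel

theorem isStrategy_six : IsStrategy attackTableSix copStrategySix := by decide +kernel

theorem isCopWin_two_knightGraph_six : IsCopWin (knightGraph 6) 2 :=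
  isCopWin_two_of_strategy isAttackTable_six isStrategy_six 2528 (by norm_num) (by norm_num)
    (by decide +kernel)

/-! ### Two cops against a robber who must move -/

/-- The displacement `(p, q)` is a knight's move. -/
def IsKnightStep (p q : ℤ) : Prop :=
  (|p| = 1 ∧ |q| = 2) ∨ (|p| = 2 ∧ |q| = 1)

theorem isKnightStep_iff {p q : ℤ} : IsKnightStep p q ↔
    ((p = 1 ∨ p = -1) ∧ (q = 2 ∨ q = -2)) ∨ ((p = 2 ∨ p = -2) ∧ (q = 1 ∨ q = -1)) := by
  rw [IsKnightStep, abs_eq zero_le_one, abs_eq zero_le_two, abs_eq zero_le_one, abs_eq zero_le_two]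

/-- The square `(x, y)` lies on the `n × n` board. -/
def OnBoard (n x y : ℤ) : Prop := (0 ≤ x ∧ x < n) ∧ 0 ≤ y ∧ y < n

/-- A cop at `(a, b)` relative to the robber gets to `(a', b')` relative to the robber by a move
(possibly standing still), after the robber has moved by `(p, q)`; here `(X, Y)` is the robber's
new square. -/
def CopReply (n X Y p q a b a' b' : ℤ) : Prop :=
  OnBoard n (X + a') (Y + b') ∧
    ((a' - a + p = 0 ∧ b' - b + q = 0) ∨ IsKnightStep (a' - a + p) (b' - b + q))

/-- Two cops at `(a, b)` and `(c, d)` relative to a robber at `(x, y)`, with the robber to move, win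
on the `n × n` board against a robber who never stands still. -/
inductive PairWins (n : ℤ) : ℤ → ℤ → ℤ → ℤ → ℤ → ℤ → Prop
  | intro (x y a b c d : ℤ) (f g : ℤ → ℤ → ℤ × ℤ)
      (h : ∀ p q, IsKnightStep p q → OnBoard n (x + p) (y + q) →
        ¬ IsKnightStep (a - p) (b - q) → ¬ IsKnightStep (c - p) (d - q) →
        CopReply n (x + p) (y + q) p q a b (f p q).1 (f p q).2 ∧
        CopReply n (x + p) (y + q) p q c d (g p q).1 (g p q).2)
      (hw : ∀ p q, IsKnightStep p q → OnBoard n (x + p) (y + q) →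
        ¬ IsKnightStep (a - p) (b - q) → ¬ IsKnightStep (c - p) (d - q) →
        PairWins n (x + p) (y + q) (f p q).1 (f p q).2 (g p q).1 (g p q).2) :
      PairWins n x y a b c d

namespace PairWins

variable {n x y a b c d : ℤ}

/-- The constructor takes the replies as functions `f` and `g`, which keeps the recursion direct;
choice recovers the rule with existential replies. -/
theorem mk (h : ∀ p q, IsKnightStep p q → OnBoard n (x + p) (y + q) →
    IsKnightStep (a - p) (b - q) ∨ IsKnightStep (c - p) (d - q) ∨
    ∃ a' b' c' d', CopReply n (x + p) (y + q) p q a b a' b' ∧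
      CopReply n (x + p) (y + q) p q c d c' d' ∧ PairWins n (x + p) (y + q) a' b' c' d') :
    PairWins n x y a b c d := by
  have h' : ∀ p q, ∃ s : (ℤ × ℤ) × (ℤ × ℤ), IsKnightStep p q → OnBoard n (x + p) (y + q) →
      ¬ IsKnightStep (a - p) (b - q) → ¬ IsKnightStep (c - p) (d - q) →
      CopReply n (x + p) (y + q) p q a b s.1.1 s.1.2 ∧
      CopReply n (x + p) (y + q) p q c d s.2.1 s.2.2 ∧
      PairWins n (x + p) (y + q) s.1.1 s.1.2 s.2.1 s.2.2 := by
    intro p q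
    by_cases hs : ∃ s : (ℤ × ℤ) × (ℤ × ℤ), CopReply n (x + p) (y + q) p q a b s.1.1 s.1.2 ∧
        CopReply n (x + p) (y + q) p q c d s.2.1 s.2.2 ∧
        PairWins n (x + p) (y + q) s.1.1 s.1.2 s.2.1 s.2.2
    · obtain ⟨s, hs⟩ := hs
      exact ⟨s, fun _ _ _ _ => hs⟩
    -- A dummy value: without a winning reply, the move is illegal or captured at once.
    · refine ⟨((0, 0), (0, 0)), fun h1 h2 h3 h4 => absurd ?_ hs⟩
      obtain h5 | h5 | ⟨a', b', c', d', h5⟩ := h p q h1 h2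
      exacts [absurd h5 h3, absurd h5 h4, ⟨((a', b'), (c', d')), h5⟩]
  choose s hs using h'
  exact intro x y a b c d (fun p q => (s p q).1) (fun p q => (s p q).2)
    (fun p q h1 h2 h3 h4 => ⟨(hs p q h1 h2 h3 h4).1, (hs p q h1 h2 h3 h4).2.1⟩)
    (fun p q h1 h2 h3 h4 => (hs p q h1 h2 h3 h4).2.2)

theorem exchange (h : PairWins n x y a b c d) : PairWins n x y c d a b := by
  induction h with
  | intro x y a b c d f g hl hw ih =>
    exact intro x y c d a b g f (fun p q h1 h2 h3 h4 => (hl p q h1 h2 h4 h3).symm)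
      fun p q h1 h2 h3 h4 => ih p q h1 h2 h4 h3

theorem reflect (h : PairWins n x y a b c d) : PairWins n (n - 1 - x) y (-a) b (-c) d := by
  induction h with
  | intro x y a b c d f g hl hw ih =>
    refine mk fun p q h1 h2 => ?_
    have h1' : IsKnightStep (-p) q := by simpa [IsKnightStep] using h1
    have h2' : OnBoard n (x + -p) (y + q) := by unfold OnBoard at *; omega
    by_cases h3 : IsKnightStep (a - -p) (b - q)
    · left
      unfold IsKnightStep at *
      rwa [show -a - p = -(a - -p) by ring, abs_neg]
    by_cases h4 : IsKnightStep (c - -p) (d - q)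
    · right; left
      unfold IsKnightStep at *
      rwa [show -c - p = -(c - -p) by ring, abs_neg]
    have hr : ∀ a b a' b' : ℤ, CopReply n (x + -p) (y + q) (-p) q a b a' b' →
        CopReply n (n - 1 - x + p) (y + q) p q (-a) b (-a') b' := by
      rintro a b a' b' ⟨h5, h6⟩
      refine ⟨by unfold OnBoard at *; omega, h6.imp (by omega) fun h7 => ?_⟩
      unfold IsKnightStep at *
      rwa [show -a' - -a + p = -(a' - a + -p) by ring, abs_neg]
    refine Or.inr (Or.inr ⟨_, _, _, _, hr _ _ _ _ (hl _ _ h1' h2' h3 h4).1,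
      hr _ _ _ _ (hl _ _ h1' h2' h3 h4).2, ?_⟩)
    have := ih _ _ h1' h2' h3 h4
    rwa [show n - 1 - (x + -p) = n - 1 - x + p by ring] at this

theorem transpose (h : PairWins n x y a b c d) : PairWins n y x b a d c := by
  induction h with
  | intro x y a b c d f g hl hw ih =>
    have hk : ∀ {p q : ℤ}, IsKnightStep p q → IsKnightStep q p := fun h =>
      h.elim (fun h => Or.inr h.symm) fun h => Or.inl h.symm
    refine mk fun p q h1 h2 => ?_
    by_cases h3 : IsKnightStep (a - q) (b - p)
    · exact Or.inl (hk h3)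
    by_cases h4 : IsKnightStep (c - q) (d - p)
    · exact Or.inr (Or.inl (hk h4))
    have hr : ∀ a b a' b' : ℤ, CopReply n (x + q) (y + p) q p a b a' b' →
        CopReply n (y + p) (x + q) p q b a b' a' := fun a b a' b' h =>
      ⟨h.1.symm, h.2.imp And.symm hk⟩
    exact Or.inr (Or.inr ⟨_, _, _, _, hr _ _ _ _ (hl _ _ (hk h1) h2.symm h3 h4).1,
      hr _ _ _ _ (hl _ _ (hk h1) h2.symm h3 h4).2, ih _ _ (hk h1) h2.symm h3 h4⟩)

theorem of_reflect (h : PairWins n (n - 1 - x) y (-a) b (-c) d) : PairWins n x y a b c d := by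
  have := h.reflect
  rwa [neg_neg, neg_neg, show n - 1 - (n - 1 - x) = x by ring] at this

theorem of_reflect' (h : PairWins n x (n - 1 - y) a (-b) c (-d)) : PairWins n x y a b c d := by
  have := h.transpose.of_reflect
  exact this.transpose

/-- The cops may reply to `(p, q)` by moving to the relative positions `(a', b')`, `(c', d')`. -/
theorem go {p q : ℤ} (a' b' c' d' : ℤ)
    (h : (CopReply n (x + p) (y + q) p q a b a' b' ∧ CopReply n (x + p) (y + q) p q c d c' d'))
    (hw : PairWins n (x + p) (y + q) a' b' c' d') :
    IsKnightStep (a - p) (b - q) ∨ IsKnightStep (c - p) (d - q) ∨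
    ∃ a' b' c' d', CopReply n (x + p) (y + q) p q a b a' b' ∧
      CopReply n (x + p) (y + q) p q c d c' d' ∧ PairWins n (x + p) (y + q) a' b' c' d' :=
  Or.inr (Or.inr ⟨a', b', c', d', h.1, h.2, hw⟩)

/-- It suffices to answer each of the eight moves of the robber. -/
theorem of_eight
    (h : ∀ p q, OnBoard n (x + p) (y + q) →
      ((p = 1 ∧ q = 2) ∨ (p = 1 ∧ q = -2) ∨ (p = -1 ∧ q = 2) ∨ (p = -1 ∧ q = -2) ∨
        (p = 2 ∧ q = 1) ∨ (p = 2 ∧ q = -1) ∨ (p = -2 ∧ q = 1) ∨ (p = -2 ∧ q = -1)) →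
      IsKnightStep (a - p) (b - q) ∨ IsKnightStep (c - p) (d - q) ∨
      ∃ a' b' c' d', CopReply n (x + p) (y + q) p q a b a' b' ∧
        CopReply n (x + p) (y + q) p q c d c' d' ∧ PairWins n (x + p) (y + q) a' b' c' d') :
    PairWins n x y a b c d :=
  mk fun p q h1 h2 => h p q h2 (by rw [isKnightStep_iff] at h1; omega)

end PairWins

/-! ### A stack two squares away in the robber's row or column -/

namespace PairWins

variable {n x y a b : ℤ}

/-- Two cops two and four squares to the right of the robber drive him to the left. -/
theorem two_four (hx : 0 ≤ x) (hx' : x + 4 < n) (hy : 0 ≤ y) (hy' : y < n) :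
    PairWins n x y 2 0 4 0 := by
  obtain ⟨m, hm⟩ : ∃ m : ℕ, x ≤ m := ⟨x.toNat, Int.self_le_toNat x⟩
  induction m using Nat.strong_induction_on generalizing x y with
  | _ m ih =>
  -- Every step to the right is captured; after a step to the left both cops copy it, and `x` has
  -- decreased.
  have keep : ∀ p q : ℤ, p < 0 → OnBoard n (x + p) (y + q) → IsKnightStep p q →
      IsKnightStep (2 - p) (0 - q) ∨ IsKnightStep (4 - p) (0 - q) ∨
      ∃ a' b' c' d', CopReply n (x + p) (y + q) p q 2 0 a' b' ∧
        CopReply n (x + p) (y + q) p q 4 0 c' d' ∧ PairWins n (x + p) (y + q) a' b' c' d' := by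
    intro p q hp hb hk
    unfold OnBoard at hb
    refine go 2 0 4 0 ?_ (ih (m - 1) (by omega) (by omega) (by omega) (by omega) (by omega)
      (by omega))
    simp only [isKnightStep_iff, CopReply, OnBoard] at *
    omega
  refine of_eight fun p q hb h => ?_
  rcases h with ⟨rfl, rfl⟩ | ⟨rfl, rfl⟩ | ⟨rfl, rfl⟩ | ⟨rfl, rfl⟩ | ⟨rfl, rfl⟩ | ⟨rfl, rfl⟩ |
    ⟨rfl, rfl⟩ | ⟨rfl, rfl⟩
  · left; norm_num [IsKnightStep]
  · left; norm_num [IsKnightStep]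
  · exact keep _ _ (by norm_num) hb (by norm_num [IsKnightStep])
  · exact keep _ _ (by norm_num) hb (by norm_num [IsKnightStep])
  · right; left; norm_num [IsKnightStep]
  · right; left; norm_num [IsKnightStep]
  · exact keep _ _ (by norm_num) hb (by norm_num [IsKnightStep])
  · exact keep _ _ (by norm_num) hb (by norm_num [IsKnightStep])

/-- Two cops at the relative positions `(2, 0)` and `(1, 3)`, or `(2, 0)` and `(3, 3)`, drive the
robber down. -/
theorem drive_down (_hn : 7 ≤ n) (m : ℕ) : ∀ y : ℤ, 0 ≤ y → y + 3 < n → y ≤ m →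
    (∀ x, 0 ≤ x → x + 2 < n → PairWins n x y 2 0 1 3) ∧
    (∀ x, 0 ≤ x → x + 3 < n → PairWins n x y 2 0 3 3) := by
  induction m using Nat.strong_induction_on with
  | _ m ih =>
  intro y hy hy' hm
  have hone : ∀ x' y', 0 ≤ y' → y' < y → 0 ≤ x' → x' + 2 < n → PairWins n x' y' 2 0 1 3 :=
    fun x' y' h1 h2 h3 h4 =>
      (ih (m - 1) (by omega) y' h1 (by omega) (by omega)).1 x' h3 h4
  have hthree : ∀ x' y', 0 ≤ y' → y' < y → 0 ≤ x' → x' + 3 < n → PairWins n x' y' 2 0 3 3 :=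
    fun x' y' h1 h2 h3 h4 =>
      (ih (m - 1) (by omega) y' h1 (by omega) (by omega)).2 x' h3 h4
  constructor
  · intro x hx hx'
    refine of_eight fun p q hb h => ?_
    unfold OnBoard at hb
    rcases h with ⟨rfl, rfl⟩ | ⟨rfl, rfl⟩ | ⟨rfl, rfl⟩ | ⟨rfl, rfl⟩ | ⟨rfl, rfl⟩ | ⟨rfl, rfl⟩ |
      ⟨rfl, rfl⟩ | ⟨rfl, rfl⟩
    · left; norm_num [IsKnightStep]
    · left; norm_num [IsKnightStep]
    · right; left; norm_num [IsKnightStep]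
    · refine go 2 0 1 3 ?_ (hone _ _ (by omega) (by omega) (by omega) (by omega))
      simp only [isKnightStep_iff, CopReply, OnBoard]
      omega
    · right; left; norm_num [IsKnightStep]
    · by_cases hedge : x + 4 < n
      · refine go 2 0 1 3 ?_ (hone _ _ (by omega) (by omega) (by omega) (by omega))
        simp only [isKnightStep_iff, CopReply, OnBoard]
        omega
      -- The robber has reached the last column, so the cops pass to his left, into the mirror image
      -- of the other pattern.
      · refine go (-2) 0 (-3) 3 ?_
          (of_reflect (hthree _ _ (by omega) (by omega) (by omega) (by omega)))
        simp only [isKnightStep_iff, CopReply, OnBoard]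
        omega
    · refine go 2 0 4 0 ?_ (two_four (by omega) (by omega) (by omega) (by omega))
      simp only [isKnightStep_iff, CopReply, OnBoard]
      omega
    · refine go 2 0 1 3 ?_ (hone _ _ (by omega) (by omega) (by omega) (by omega))
      simp only [isKnightStep_iff, CopReply, OnBoard]
      omega
  · intro x hx hx'
    refine of_eight fun p q hb h => ?_
    unfold OnBoard at hb
    rcases h with ⟨rfl, rfl⟩ | ⟨rfl, rfl⟩ | ⟨rfl, rfl⟩ | ⟨rfl, rfl⟩ | ⟨rfl, rfl⟩ | ⟨rfl, rfl⟩ |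
      ⟨rfl, rfl⟩ | ⟨rfl, rfl⟩
    · left; norm_num [IsKnightStep]
    · left; norm_num [IsKnightStep]
    · refine go 4 0 2 0 ?_ (two_four (by omega) (by omega) (by omega) (by omega)).exchange
      simp only [isKnightStep_iff, CopReply, OnBoard]
      omega
    · refine go 2 0 3 3 ?_ (hthree _ _ (by omega) (by omega) (by omega) (by omega))
      simp only [isKnightStep_iff, CopReply, OnBoard]
      omega
    · right; left; norm_num [IsKnightStep]
    · refine go (-2) 0 (-1) 3 ?_
        (of_reflect (hone _ _ (by omega) (by omega) (by omega) (by omega)))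
      simp only [isKnightStep_iff, CopReply, OnBoard]
      omega
    · refine go 2 0 4 0 ?_ (two_four (by omega) (by omega) (by omega) (by omega))
      simp only [isKnightStep_iff, CopReply, OnBoard]
      omega
    · refine go 2 0 3 3 ?_ (hthree _ _ (by omega) (by omega) (by omega) (by omega))
      simp only [isKnightStep_iff, CopReply, OnBoard]
      omega

theorem two_zero_one_three (hn : 7 ≤ n) (hx : 0 ≤ x) (hx' : x + 2 < n) (hy : 0 ≤ y)
    (hy' : y + 3 < n) : PairWins n x y 2 0 1 3 :=
  (drive_down hn y.toNat y hy hy' (Int.self_le_toNat y)).1 x hx hx'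

theorem two_zero_three_three (hn : 7 ≤ n) (hx : 0 ≤ x) (hx' : x + 3 < n) (hy : 0 ≤ y)
    (hy' : y + 3 < n) : PairWins n x y 2 0 3 3 :=
  (drive_down hn y.toNat y hy hy' (Int.self_le_toNat y)).2 x hx hx'

theorem two_zero_one_neg_three (hn : 7 ≤ n) (hx : 0 ≤ x) (hx' : x + 2 < n) (hy : 3 ≤ y)
    (hy' : y < n) : PairWins n x y 2 0 1 (-3) :=
  of_reflect' (two_zero_one_three hn hx hx' (by omega) (by omega))

theorem two_zero_three_neg_three (hn : 7 ≤ n) (hx : 0 ≤ x) (hx' : x + 3 < n) (hy : 3 ≤ y)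
    (hy' : y < n) : PairWins n x y 2 0 3 (-3) :=
  of_reflect' (two_zero_three_three hn hx hx' (by omega) (by omega))

/-- If both cops are two squares to the right of the robber, any move after which the robber is
not too close to the edge in the direction he came from splits them into a winning position. -/
theorem two_two_reply (hn : 7 ≤ n) (hx : 0 ≤ x) (hx' : x + 2 < n) {p q : ℤ}
    (hb : OnBoard n (x + p) (y + q)) (hk : IsKnightStep p q) (h : 0 ≤ y - 2 * q.sign)
    (h' : y - 2 * q.sign < n) :
    IsKnightStep (2 - p) (0 - q) ∨ IsKnightStep (2 - p) (0 - q) ∨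
      ∃ a' b' c' d', CopReply n (x + p) (y + q) p q 2 0 a' b' ∧
        CopReply n (x + p) (y + q) p q 2 0 c' d' ∧ PairWins n (x + p) (y + q) a' b' c' d' := by
  unfold OnBoard at hb
  rw [isKnightStep_iff] at hk
  -- Unless the move is captured, one cop returns to the robber's row at distance two, and the other
  -- goes three rows away on the side the robber came from; this drives him onward.
  obtain ⟨hp | hp, hq | hq⟩ | ⟨hp | hp, hq | hq⟩ := hk <;> subst hp <;> subst hq <;>
    norm_num at h h'
  · left; norm_num [IsKnightStep]
  · left; norm_num [IsKnightStep]
  · refine go 2 0 1 (-3) ?_ (two_zero_one_neg_three hn (by omega) (by omega) (by omega) (by omega))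
    simp only [isKnightStep_iff, CopReply, OnBoard]
    omega
  · refine go 2 0 1 3 ?_ (two_zero_one_three hn (by omega) (by omega) (by omega) (by omega))
    simp only [isKnightStep_iff, CopReply, OnBoard]
    omega
  · refine go (-2) 0 (-1) (-3) ?_
      (of_reflect (two_zero_one_neg_three hn (by omega) (by omega) (by omega) (by omega)))
    simp only [isKnightStep_iff, CopReply, OnBoard]
    omega
  · refine go (-2) 0 (-1) 3 ?_
      (of_reflect (two_zero_one_three hn (by omega) (by omega) (by omega) (by omega)))
    simp only [isKnightStep_iff, CopReply, OnBoard]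
    omega
  · refine go 2 0 3 (-3) ?_
      (two_zero_three_neg_three hn (by omega) (by omega) (by omega) (by omega))
    simp only [isKnightStep_iff, CopReply, OnBoard]
    omega
  · refine go 2 0 3 3 ?_ (two_zero_three_three hn (by omega) (by omega) (by omega) (by omega))
    simp only [isKnightStep_iff, CopReply, OnBoard]
    omega

theorem two_two_of_middle (hn : 7 ≤ n) (hx : 0 ≤ x) (hx' : x + 2 < n) (hy : 2 ≤ y)
    (hy' : y + 2 < n) : PairWins n x y 2 0 2 0 := by
  refine mk fun p q hk hb => two_two_reply hn hx hx' hb hk ?_ ?_ <;>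
  · rcases lt_trichotomy q 0 with h | rfl | h
    · rw [Int.sign_eq_neg_one_of_neg h]; omega
    · simp; omega
    · rw [Int.sign_eq_one_of_pos h]; omega

/-- A robber who moves up from the two lowest rows leaves no room below him for the split, so the
cops stay stacked, now nearer to the middle rows. When he moves down, the splitting reply is
available. -/
theorem two_two_of_low (hn : 7 ≤ n) (hx : 0 ≤ x) (hx' : x + 2 < n) (hy : 0 ≤ y) (hy' : y ≤ 1)
    (ih : ∀ x' y', 0 ≤ x' → x' + 2 < n → y < y' → y' ≤ y + 2 → PairWins n x' y' 2 0 2 0) :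
    PairWins n x y 2 0 2 0 := by
  refine of_eight fun p q hb h => ?_
  have hb' := hb
  unfold OnBoard at hb
  rcases h with ⟨rfl, rfl⟩ | ⟨rfl, rfl⟩ | ⟨rfl, rfl⟩ | ⟨rfl, rfl⟩ | ⟨rfl, rfl⟩ | ⟨rfl, rfl⟩ |
    ⟨rfl, rfl⟩ | ⟨rfl, rfl⟩
  · left; norm_num [IsKnightStep]
  · left; norm_num [IsKnightStep]
  · refine go 2 0 2 0 ?_ (ih _ _ (by omega) (by omega) (by omega) (by omega))
    simp only [isKnightStep_iff, CopReply, OnBoard]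
    omega
  · omega
  · refine go (-2) 0 (-2) 0 ?_ (of_reflect (ih _ _ (by omega) (by omega) (by omega) (by omega)))
    simp only [isKnightStep_iff, CopReply, OnBoard]
    omega
  · exact two_two_reply hn hx hx' hb' (by norm_num [IsKnightStep])
      (by norm_num; omega) (by norm_num; omega)
  · refine go 2 0 2 0 ?_ (ih _ _ (by omega) (by omega) (by omega) (by omega))
    simp only [isKnightStep_iff, CopReply, OnBoard]
    omega
  · exact two_two_reply hn hx hx' hb' (by norm_num [IsKnightStep])
      (by norm_num; omega) (by norm_num; omega)

theorem two_two (hn : 7 ≤ n) (hx : 0 ≤ x) (hx' : x + 2 < n) (hy : 0 ≤ y) (hy' : y < n) :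
    PairWins n x y 2 0 2 0 := by
  have low : ∀ x y, 0 ≤ x → x + 2 < n → 0 ≤ y → y + 2 < n → PairWins n x y 2 0 2 0 := by
    have one : ∀ x y, 0 ≤ x → x + 2 < n → 1 ≤ y → y + 2 < n → PairWins n x y 2 0 2 0 := by
      intro x y h1 h2 h3 h4
      rcases (show y = 1 ∨ 2 ≤ y by omega) with rfl | h5
      · exact two_two_of_low hn h1 h2 (by omega) le_rfl fun x' y' h1 h2 h3 h4 =>
          two_two_of_middle hn h1 h2 (by omega) (by omega)
      · exact two_two_of_middle hn h1 h2 h5 h4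
    intro x y h1 h2 h3 h4
    rcases (show y = 0 ∨ 1 ≤ y by omega) with rfl | h5
    · exact two_two_of_low hn h1 h2 le_rfl zero_le_one fun x' y' h1 h2 h3 h4 =>
        one x' y' h1 h2 (by omega) (by omega)
    · exact one x y h1 h2 h5 h4
  rcases (show y + 2 < n ∨ n ≤ y + 2 by omega) with h | h
  · exact low x y hx hx' hy h
  · exact of_reflect' (by simpa using low x (n - 1 - y) hx hx' (by omega) (by omega))

/-- Two cops on the same square win if they are two squares away from the robber in his row. -/
theorem row (hn : 7 ≤ n) (hb : OnBoard n x y) (ha : a = 2 ∨ a = -2) (hb' : OnBoard n (x + a) y) :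
    PairWins n x y a 0 a 0 := by
  unfold OnBoard at hb hb'
  rcases ha with rfl | rfl
  · exact two_two hn (by omega) (by omega) (by omega) (by omega)
  · exact of_reflect (two_two hn (by omega) (by omega) (by omega) (by omega))

theorem column (hn : 7 ≤ n) (hb : OnBoard n x y) (ha : b = 2 ∨ b = -2)
    (hb' : OnBoard n x (y + b)) : PairWins n x y 0 b 0 b :=
  (row hn hb.symm ha hb'.symm).transpose

end PairWins

/-! ### Stacked cops in arbitrary position -/

namespace PairWins

variable {n x y a b : ℤ}

/-- For `one_one`: when the robber steps onto the last column, copying him would take the cops off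
the board, so they end up at `(-1, 1)` instead. -/
theorem neg_one_one_of_edge (hn : 7 ≤ n) (hy : 0 ≤ y) (hy' : y + 1 < n)
    (h : 2 ≤ y → PairWins n (n - 2) (y - 2) 1 1 1 1) : PairWins n (n - 1) y (-1) 1 (-1) 1 := by
  refine of_eight fun p q hb hpq => ?_
  have hb' := hb
  unfold OnBoard at hb
  rcases hpq with ⟨rfl, rfl⟩ | ⟨rfl, rfl⟩ | ⟨rfl, rfl⟩ | ⟨rfl, rfl⟩ | ⟨rfl, rfl⟩ | ⟨rfl, rfl⟩ |
    ⟨rfl, rfl⟩ | ⟨rfl, rfl⟩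
  · omega
  · omega
  · refine go (-2) 0 (-2) 0 ?_ (row hn hb' (Or.inr rfl) (by unfold OnBoard; omega))
    simp only [isKnightStep_iff, CopReply, OnBoard]
    omega
  · have h := h (by omega)
    rw [show n - 2 = n - 1 + -1 by ring, show y - 2 = y + -2 by ring] at h
    refine go 1 1 1 1 ?_ h
    simp only [isKnightStep_iff, CopReply, OnBoard]
    omega
  · omega
  · omega
  · rcases (show y + 3 < n ∨ 1 ≤ y by omega) with h1 | h1
    · refine go 0 2 0 2 ?_ (column hn hb' (Or.inl rfl) (by unfold OnBoard; omega))
      simp only [isKnightStep_iff, CopReply, OnBoard]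
      omega
    · refine go 0 (-2) 0 (-2) ?_ (column hn hb' (Or.inr rfl) (by unfold OnBoard; omega))
      simp only [isKnightStep_iff, CopReply, OnBoard]
      omega
  · left; norm_num [IsKnightStep]

/-- Two of the robber's moves are captured, and four let the stack get two squares away in his row
or column. The remaining ones, `(1, -2)` and `(-2, 1)`, lower `x + y`; the cops copy them if the
edge allows. -/
theorem one_one (hn : 7 ≤ n) (hx : 0 ≤ x) (hx' : x + 1 < n) (hy : 0 ≤ y) (hy' : y + 1 < n) :
    PairWins n x y 1 1 1 1 := by
  obtain ⟨m, hm⟩ : ∃ m : ℕ, x + y ≤ m := ⟨(x + y).toNat, Int.self_le_toNat _⟩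
  induction m using Nat.strong_induction_on generalizing x y with
  | _ m ih =>
  have ih' : ∀ x' y', 0 ≤ x' → x' + 1 < n → 0 ≤ y' → y' + 1 < n → x' + y' < x + y →
      PairWins n x' y' 1 1 1 1 := fun x' y' h1 h2 h3 h4 h5 =>
    ih (m - 1) (by omega) h1 h2 h3 h4 (by omega)
  refine of_eight fun p q hb hpq => ?_
  have hb' := hb
  unfold OnBoard at hb
  rcases hpq with ⟨rfl, rfl⟩ | ⟨rfl, rfl⟩ | ⟨rfl, rfl⟩ | ⟨rfl, rfl⟩ | ⟨rfl, rfl⟩ | ⟨rfl, rfl⟩ |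
    ⟨rfl, rfl⟩ | ⟨rfl, rfl⟩
  · rcases (show x + 3 < n ∨ 1 ≤ x by omega) with h1 | h1
    · refine go 2 0 2 0 ?_ (row hn hb' (Or.inl rfl) (by unfold OnBoard; omega))
      simp only [isKnightStep_iff, CopReply, OnBoard]
      omega
    · refine go (-2) 0 (-2) 0 ?_ (row hn hb' (Or.inr rfl) (by unfold OnBoard; omega))
      simp only [isKnightStep_iff, CopReply, OnBoard]
      omega
  · by_cases h1 : x + 2 < n
    · refine go 1 1 1 1 ?_ (ih' _ _ (by omega) (by omega) (by omega) (by omega) (by omega))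
      simp only [isKnightStep_iff, CopReply, OnBoard]
      omega
    · obtain rfl : x = n - 2 := by omega
      rw [show n - 2 + 1 = n - 1 by ring] at *
      have h2 : PairWins n (n - 1) (y + -2) (-1) 1 (-1) 1 :=
        neg_one_one_of_edge hn (by omega) (by omega) fun _ =>
          ih' _ _ (by omega) (by omega) (by omega) (by omega) (by omega)
      rw [show n - 1 = n - 2 + 1 by ring] at h2 ⊢
      refine go (-1) 1 (-1) 1 ?_ h2
      simp only [isKnightStep_iff, CopReply, OnBoard]
      omega
  · left; norm_num [IsKnightStep]
  · refine go 0 2 0 2 ?_ (column hn hb' (Or.inl rfl) (by unfold OnBoard; omega))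
    simp only [isKnightStep_iff, CopReply, OnBoard]
    omega
  · rcases (show y + 3 < n ∨ 1 ≤ y by omega) with h1 | h1
    · refine go 0 2 0 2 ?_ (column hn hb' (Or.inl rfl) (by unfold OnBoard; omega))
      simp only [isKnightStep_iff, CopReply, OnBoard]
      omega
    · refine go 0 (-2) 0 (-2) ?_ (column hn hb' (Or.inr rfl) (by unfold OnBoard; omega))
      simp only [isKnightStep_iff, CopReply, OnBoard]
      omega
  · left; norm_num [IsKnightStep]
  · by_cases h1 : y + 2 < n
    · refine go 1 1 1 1 ?_ (ih' _ _ (by omega) (by omega) (by omega) (by omega) (by omega))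
      simp only [isKnightStep_iff, CopReply, OnBoard]
      omega
    · obtain rfl : y = n - 2 := by omega
      have h2 : PairWins n (n - 1) (x + -2) (-1) 1 (-1) 1 :=
        neg_one_one_of_edge hn (by omega) (by omega) fun _ =>
          ih' _ _ (by omega) (by omega) (by omega) (by omega) (by omega)
      rw [show n - 1 = n - 2 + 1 by ring] at h2
      refine go 1 (-1) 1 (-1) ?_ h2.transpose
      simp only [isKnightStep_iff, CopReply, OnBoard]
      omega
  · refine go 2 0 2 0 ?_ (row hn hb' (Or.inl rfl) (by unfold OnBoard; omega))
    simp only [isKnightStep_iff, CopReply, OnBoard]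
    omega

/-- Copying `(-1, -2)` and `(-2, -1)` drives the robber towards the corner, so `x + y` decreases.
Any other move lets the cops reach a row, column or diagonally adjacent stack. -/
theorem diagonal_two (hn : 7 ≤ n) (hx : 0 ≤ x) (hx' : x + 2 < n) (hy : 0 ≤ y) (hy' : y + 2 < n) :
    PairWins n x y 2 2 2 2 := by
  obtain ⟨m, hm⟩ : ∃ m : ℕ, x + y ≤ m := ⟨(x + y).toNat, Int.self_le_toNat _⟩
  induction m using Nat.strong_induction_on generalizing x y with
  | _ m ih =>
  refine of_eight fun p q hb hpq => ?_
  have hb' := hb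
  unfold OnBoard at hb
  rcases hpq with ⟨rfl, rfl⟩ | ⟨rfl, rfl⟩ | ⟨rfl, rfl⟩ | ⟨rfl, rfl⟩ | ⟨rfl, rfl⟩ | ⟨rfl, rfl⟩ |
    ⟨rfl, rfl⟩ | ⟨rfl, rfl⟩
  · refine go 0 (-2) 0 (-2) ?_ (column hn hb' (Or.inr rfl) (by unfold OnBoard; omega))
    simp only [isKnightStep_iff, CopReply, OnBoard]
    omega
  · refine go 0 2 0 2 ?_ (column hn hb' (Or.inl rfl) (by unfold OnBoard; omega))
    simp only [isKnightStep_iff, CopReply, OnBoard]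
    omega
  · refine go 1 (-1) 1 (-1) ?_
      (of_reflect' (one_one hn (by omega) (by omega) (by omega) (by omega)))
    simp only [isKnightStep_iff, CopReply, OnBoard]
    omega
  · refine go 2 2 2 2 ?_
      (ih (m - 1) (by omega) (by omega) (by omega) (by omega) (by omega) (by omega))
    simp only [isKnightStep_iff, CopReply, OnBoard]
    omega
  · refine go (-2) 0 (-2) 0 ?_ (row hn hb' (Or.inr rfl) (by unfold OnBoard; omega))
    simp only [isKnightStep_iff, CopReply, OnBoard]
    omega
  · refine go (-1) 1 (-1) 1 ?_
      (of_reflect (one_one hn (by omega) (by omega) (by omega) (by omega)))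
    simp only [isKnightStep_iff, CopReply, OnBoard]
    omega
  · refine go 2 0 2 0 ?_ (row hn hb' (Or.inl rfl) (by unfold OnBoard; omega))
    simp only [isKnightStep_iff, CopReply, OnBoard]
    omega
  · refine go 2 2 2 2 ?_
      (ih (m - 1) (by omega) (by omega) (by omega) (by omega) (by omega) (by omega))
    simp only [isKnightStep_iff, CopReply, OnBoard]
    omega

theorem zero_zero : PairWins n x y 0 0 0 0 :=
  mk fun p q h _ => Or.inl (by simpa [IsKnightStep] using h)

theorem stack_of_abs_le_two (hn : 7 ≤ n) (hb : OnBoard n x y) (hb' : OnBoard n (x + a) (y + b))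
    (ha : a = 0 ∨ a = 2 ∨ a = -2) (hb2 : b = 0 ∨ b = 2 ∨ b = -2) : PairWins n x y a b a b := by
  rcases hb2 with rfl | hb2
  · rcases ha with rfl | ha
    · exact zero_zero
    · exact row hn hb ha (by simpa using hb')
  rcases ha with rfl | ha
  · exact column hn hb hb2 (by simpa using hb')
  unfold OnBoard at hb hb'
  rcases ha with rfl | rfl <;> rcases hb2 with rfl | rfl
  · exact diagonal_two hn (by omega) (by omega) (by omega) (by omega)
  · exact of_reflect' (diagonal_two hn (by omega) (by omega) (by omega) (by omega))
  · exact of_reflect (diagonal_two hn (by omega) (by omega) (by omega) (by omega))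
  · exact of_reflect (of_reflect' (diagonal_two hn (by omega) (by omega) (by omega) (by omega)))

/-- In one coordinate, a cop at an even distance can copy the robber's step `p` or its reflection
so as not to increase the distance, and to decrease it if it is at least `4` and the robber comes
closer. -/
theorem exists_mirror_step {p : ℤ} (ha : 2 ∣ a) (hx : 0 ≤ x ∧ x < n)
    (hxa : 0 ≤ x + a ∧ x + a < n) (hxp : 0 ≤ x + p ∧ x + p < n)
    (hp : (p = 1 ∨ p = -1) ∨ p = 2 ∨ p = -2) :
    ∃ a', 2 ∣ a' ∧ (0 ≤ x + p + a' ∧ x + p + a' < n) ∧ (a' - a + p = p ∨ a' - a + p = -p) ∧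
      a'.natAbs ≤ a.natAbs ∧ (4 ≤ a.natAbs →
        a'.natAbs < a.natAbs ∨ (a' = a ∧ ((0 < a ∧ p < 0) ∨ (a < 0 ∧ 0 < p)))) := by
  -- Reflecting the step turns `a` into `a - 2 * p`, copying it keeps `a`. Reflection is used if it
  -- brings the cop closer, or if it costs nothing and copying would leave the board.
  by_cases h : (a - 2 * p).natAbs < a.natAbs ∨ ((a - 2 * p).natAbs = a.natAbs ∧
      ¬ (0 ≤ x + p + a ∧ x + p + a < n))
  · refine ⟨a - 2 * p, by omega, ?_, by omega, by omega, by omega⟩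
    rcases hp with (rfl | rfl) | rfl | rfl <;> omega
  · refine ⟨a, ha, ?_, by omega, le_rfl, ?_⟩ <;>
      rcases hp with (rfl | rfl) | rfl | rfl <;> omega

/-- A stack of two cops at even distances wins if it wins at all smaller even distances. -/
theorem stack_of_four_le {m : ℕ}
    (ih : ∀ x y a b : ℤ, OnBoard n x y → OnBoard n (x + a) (y + b) → 2 ∣ a → 2 ∣ b →
      a.natAbs + b.natAbs < m → PairWins n x y a b a b) (k : ℕ) :
    ∀ x y b : ℤ, OnBoard n x y → OnBoard n (x + a) (y + b) → 2 ∣ a → 2 ∣ b →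
      a.natAbs + b.natAbs ≤ m → 4 ≤ a.natAbs →
      ((0 < a ∧ x ≤ k) ∨ (a < 0 ∧ n - 1 - x ≤ k)) → PairWins n x y a b a b := by
  induction k using Nat.strong_induction_on with
  | _ k ihk =>
  intro x y b hr hc ha hb hm h4 hk
  refine mk fun p q hpq hr' => ?_
  rw [isKnightStep_iff] at hpq
  obtain ⟨a', ha', hxa', hpa, hle, hlt⟩ :=
    exists_mirror_step (p := p) ha hr.1 hc.1 hr'.1 (by omega)
  obtain ⟨b', hb', hyb', hqb, hle', -⟩ :=
    exists_mirror_step (p := q) hb hr.2 hc.2 hr'.2 (by omega)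
  have hreply : CopReply n (x + p) (y + q) p q a b a' b' := by
    refine ⟨⟨hxa', hyb'⟩, Or.inr ?_⟩
    clear hlt hk
    rw [isKnightStep_iff]
    rcases hpa with h | h <;> rcases hqb with h' | h' <;> rw [h, h'] <;> omega
  refine go a' b' a' b' ⟨hreply, hreply⟩ ?_
  by_cases hsmall : a'.natAbs + b'.natAbs < m
  · exact ih _ _ _ _ hr' hreply.1 ha' hb' hsmall
  -- No distance has shrunk, so the robber ran away from the cops in the first coordinate; `k`
  -- bounds his distance to the edge ahead of him, which has decreased.
  obtain ⟨rfl, hpa⟩ : a' = a ∧ ((0 < a ∧ p < 0) ∨ (a < 0 ∧ 0 < p)) :=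
    (hlt h4).resolve_left (by omega)
  unfold OnBoard at hr'
  exact ihk (k - 1) (by omega) _ _ _ hr' hreply.1 ha hb' (by omega) h4 (by omega)

theorem stack_of_even (hn : 7 ≤ n) (hr : OnBoard n x y) (hc : OnBoard n (x + a) (y + b))
    (ha : 2 ∣ a) (hb : 2 ∣ b) : PairWins n x y a b a b := by
  induction hm : a.natAbs + b.natAbs using Nat.strong_induction_on generalizing x y a b with
  | _ m ih =>
  have ih' : ∀ x y a b : ℤ, OnBoard n x y → OnBoard n (x + a) (y + b) → 2 ∣ a → 2 ∣ b →
      a.natAbs + b.natAbs < m → PairWins n x y a b a b := fun x y a b h1 h2 h3 h4 h5 =>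
    ih _ h5 h1 h2 h3 h4 rfl
  rcases (show 4 ≤ a.natAbs ∨ 4 ≤ b.natAbs ∨ (a.natAbs ≤ 3 ∧ b.natAbs ≤ 3) by omega) with h | h | h
  · unfold OnBoard at hr
    exact stack_of_four_le ih' n.toNat x y b hr hc ha hb hm.le h (by omega)
  · have hr' := hr
    unfold OnBoard at hr'
    exact (stack_of_four_le (m := m) (fun x y a b h1 h2 h3 h4 h5 =>
      (ih' y x b a h1.symm h2.symm h4 h3 (by omega)).transpose) n.toNat y x a hr.symm hc.symm hb ha
      (by omega) h (by omega)).transpose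
  · exact stack_of_abs_le_two hn hr hc (by omega) (by omega)

theorem exists_board_step (hn : 7 ≤ n) (hx : 0 ≤ x ∧ x < n) {s : ℤ} (hs : s = 1 ∨ s = 2) :
    ∃ p, (p = s ∨ p = -s) ∧ 0 ≤ x + p ∧ x + p < n := by
  by_cases h : x + s < n
  · exact ⟨s, by omega⟩
  · exact ⟨-s, by omega⟩

/-- A coordinate step of one is answered by a step of two and vice versa, which makes both
differences even. The signs are free, so the cops can stay on the board. -/
theorem stack_of_odd (hn : 7 ≤ n) (hc : OnBoard n (x + a) (y + b))
    (ha : ¬ 2 ∣ a) (hb : ¬ 2 ∣ b) : PairWins n x y a b a b := by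
  refine mk fun p q hpq hr' => ?_
  rw [isKnightStep_iff] at hpq
  obtain ⟨u, v, huv, hu, hv, hb'⟩ : ∃ u v, IsKnightStep u v ∧ 2 ∣ a - p + u ∧ 2 ∣ b - q + v ∧
      OnBoard n (x + a + u) (y + b + v) := by
    rcases hpq with hpq | hpq
    · obtain ⟨u, hu, hu'⟩ := exists_board_step hn hc.1 (Or.inr rfl)
      obtain ⟨v, hv, hv'⟩ := exists_board_step hn hc.2 (Or.inl rfl)
      exact ⟨u, v, by rw [isKnightStep_iff]; omega, by omega, by omega, hu', hv'⟩
    · obtain ⟨u, hu, hu'⟩ := exists_board_step hn hc.1 (Or.inl rfl)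
      obtain ⟨v, hv, hv'⟩ := exists_board_step hn hc.2 (Or.inr rfl)
      exact ⟨u, v, by rw [isKnightStep_iff]; omega, by omega, by omega, hu', hv'⟩
  have hreply : CopReply n (x + p) (y + q) p q a b (a - p + u) (b - q + v) := by
    refine ⟨by unfold OnBoard at *; omega, Or.inr ?_⟩
    rwa [show a - p + u - a + p = u by ring, show b - q + v - b + q = v by ring]
  exact go _ _ _ _ ⟨hreply, hreply⟩ (stack_of_even hn hr' hreply.1 hu hv)

/-- Two cops on the same square win against a robber who never stands still. -/
theorem stack (hn : 7 ≤ n) (hr : OnBoard n x y) (hc : OnBoard n (x + a) (y + b)) :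
    PairWins n x y a b a b := by
  rcases (show (2 ∣ a ∧ 2 ∣ b) ∨ (¬ 2 ∣ a ∧ ¬ 2 ∣ b) ∨ ¬ 2 ∣ a + b by omega) with h | h | h
  · exact stack_of_even hn hr hc h.1 h.2
  · exact stack_of_odd hn hc h.1 h.2
  refine mk fun p q hpq hr' => ?_
  -- When `a + b` is odd the cops stand still: the robber's own step changes the parity of the sum.
  have hreply : CopReply n (x + p) (y + q) p q a b (a - p) (b - q) :=
    ⟨by unfold OnBoard at *; omega, by omega⟩
  refine go _ _ _ _ ⟨hreply, hreply⟩ ?_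
  rw [isKnightStep_iff] at hpq
  rcases (show (2 ∣ a - p ∧ 2 ∣ b - q) ∨ (¬ 2 ∣ a - p ∧ ¬ 2 ∣ b - q) by omega) with h1 | h1
  · exact stack_of_even hn hr' hreply.1 h1.1 h1.2
  · exact stack_of_odd hn hreply.1 h1.1 h1.2

end PairWins

/-! ### The third cop -/

theorem SimpleGraph.Connected.exists_adj_dist_lt {V : Type*} {G : SimpleGraph V}
    (hG : G.Connected) {u v : V} (h : u ≠ v) : ∃ w, G.Adj u w ∧ G.dist w v < G.dist u v := by
  obtain ⟨p, hp⟩ := hG.exists_walk_length_eq_dist u v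
  cases p with
  | nil => exact absurd rfl h
  | cons hadj q =>
    refine ⟨_, hadj, ?_⟩
    rw [← hp, SimpleGraph.Walk.length_cons]
    exact Nat.lt_succ_of_le (SimpleGraph.dist_le q)

theorem knightGraph_adj_iff {n : ℕ} (u v : Fin n × Fin n) : (knightGraph n).Adj u v ↔
    IsKnightStep ((v.1 : ℤ) - (u.1 : ℤ)) ((v.2 : ℤ) - (u.2 : ℤ)) := by
  simp only [knightGraph, IsKnightStep, abs_sub_comm]

theorem onBoard_val {n : ℕ} (u : Fin n × Fin n) : OnBoard n (u.1 : ℤ) (u.2 : ℤ) := by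
  obtain ⟨⟨a, ha⟩, ⟨b, hb⟩⟩ := u
  simp only [OnBoard]
  omega

theorem exists_of_onBoard {n : ℕ} {x y : ℤ} (h : OnBoard n x y) :
    ∃ u : Fin n × Fin n, (u.1 : ℤ) = x ∧ (u.2 : ℤ) = y := by
  unfold OnBoard at h
  refine ⟨(⟨x.toNat, by omega⟩, ⟨y.toNat, by omega⟩), ?_, ?_⟩ <;> simp <;> omega

theorem exists_move_of_copReply {n : ℕ} {r' c : Fin n × Fin n} {x y a b p q a' b' : ℤ}
    (hx : (r'.1 : ℤ) = x + p) (hy : (r'.2 : ℤ) = y + q) (ha : (c.1 : ℤ) = x + a)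
    (hb : (c.2 : ℤ) = y + b) (h : CopReply n (x + p) (y + q) p q a b a' b') :
    ∃ c' : Fin n × Fin n, Move (knightGraph n) c c' ∧ (c'.1 : ℤ) = r'.1 + a' ∧
      (c'.2 : ℤ) = r'.2 + b' := by
  obtain ⟨c', h1, h2⟩ := exists_of_onBoard h.1
  refine ⟨c', ?_, by rw [h1, hx], by rw [h2, hy]⟩
  rcases h.2 with h3 | h3
  · refine Or.inl (Prod.ext (Fin.ext ?_) (Fin.ext ?_)) <;> omega
  · refine Or.inr ((knightGraph_adj_iff _ _).2 ?_)
    rwa [h1, h2, ha, hb, show x + p + a' - (x + a) = a' - a + p by ring,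
      show y + q + b' - (y + b) = b' - b + q by ring]

/-- Two cops who win against a robber who never stands still win together with a third cop, who
approaches the robber whenever he stands still. -/
theorem copsWinFrom_of_pairWins {n : ℕ} (hconn : (knightGraph n).Connected) (m : ℕ) :
    ∀ {x y a b c d : ℤ}, PairWins n x y a b c d → ∀ r c₀ c₁ c₂ : Fin n × Fin n,
      (r.1 : ℤ) = x → (r.2 : ℤ) = y → (c₀.1 : ℤ) = x + a → (c₀.2 : ℤ) = y + b →
      (c₁.1 : ℤ) = x + c → (c₁.2 : ℤ) = y + d → (knightGraph n).dist c₂ r ≤ m →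
      ∀ r', Move (knightGraph n) r r' → CopsWinFrom (knightGraph n) ![c₀, c₁, c₂] r' := by
  induction m using Nat.strong_induction_on with
  | _ m ihm =>
  intro x y a b c d h
  induction h with
  | intro x y a b c d f g hl hw ih =>
  intro r c₀ c₁ c₂ hx hy ha hb hc hd hdist r' hr'
  by_cases hcr : c₂ = r'
  · exact .captured _ _ 2 hcr
  obtain ⟨c₂', hadj, hlt⟩ := hconn.exists_adj_dist_lt hcr
  rcases hr' with rfl | hr'
  -- The robber paused: the pair waits in the same position, and the bound on the third cop's
  -- distance drops.
  · refine .step _ ![c₀, c₁, c₂'] _ (fun i => ?_) (ihm (m - 1) (by omega)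
      (PairWins.intro x y a b c d f g hl hw) r c₀ c₁ c₂' hx hy ha hb hc hd (by omega))
    fin_cases i
    exacts [Move.refl _, Move.refl _, Or.inr hadj]
  have hk := (knightGraph_adj_iff _ _).1 hr'
  obtain ⟨p, hp⟩ : ∃ p, (r'.1 : ℤ) = x + p := ⟨r'.1 - x, by ring⟩
  obtain ⟨q, hq⟩ : ∃ q, (r'.2 : ℤ) = y + q := ⟨r'.2 - y, by ring⟩
  rw [hp, hq, hx, hy, add_sub_cancel_left, add_sub_cancel_left] at hk
  have hon : OnBoard n (x + p) (y + q) := by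
    rw [← hp, ← hq]
    exact onBoard_val r'
  have hcatch : ∀ (e : Fin n × Fin n) (s t : ℤ), (e.1 : ℤ) = x + s → (e.2 : ℤ) = y + t →
      IsKnightStep (s - p) (t - q) → (knightGraph n).Adj e r' := by
    intro e s t h1 h2 h3
    refine ((knightGraph_adj_iff _ _).2 ?_).symm
    rwa [hp, hq, h1, h2, add_sub_add_left_eq_sub, add_sub_add_left_eq_sub]
  by_cases h3 : IsKnightStep (a - p) (b - q)
  · refine .capture _ ![r', c₁, c₂] _ (fun i => ?_) 0 rfl
    fin_cases i
    exacts [Or.inr (hcatch c₀ a b ha hb h3), Move.refl _, Move.refl _]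
  by_cases h4 : IsKnightStep (c - p) (d - q)
  · refine .capture _ ![c₀, r', c₂] _ (fun i => ?_) 1 rfl
    fin_cases i
    exacts [Move.refl _, Or.inr (hcatch c₁ c d hc hd h4), Move.refl _]
  obtain ⟨hf, hg⟩ := hl p q hk hon h3 h4
  obtain ⟨c₀', hm₀, h5, h6⟩ := exists_move_of_copReply hp hq ha hb hf
  obtain ⟨c₁', hm₁, h7, h8⟩ := exists_move_of_copReply hp hq hc hd hg
  -- The robber's move adds at most one to the distance and the third cop's step takes it back, so
  -- the bound `m` survives while the pair makes progress.
  have htri : (knightGraph n).dist c₂ r' ≤ (knightGraph n).dist c₂ r + 1 := by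
    have := hconn.dist_triangle (u := c₂) (v := r) (w := r')
    rwa [SimpleGraph.dist_eq_one_iff_adj.2 hr'] at this
  refine .step _ ![c₀', c₁', c₂'] _ (fun i => ?_) (ih p q hk hon h3 h4 r' c₀' c₁' c₂' hp hq
    (by rw [h5, hp]) (by rw [h6, hq]) (by rw [h7, hp]) (by rw [h8, hq]) (by omega))
  fin_cases i
  exacts [hm₀, hm₁, Or.inr hadj]

theorem isCopWin_three_knightGraph {n : ℕ} (hn : 7 ≤ n) (hconn : (knightGraph n).Connected) :
    IsCopWin (knightGraph n) 3 := by
  let o : Fin n × Fin n := (⟨0, by omega⟩, ⟨0, by omega⟩)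
  -- The cops pass their first turn, because `PairWins` has the robber to move.
  refine ⟨![o, o, o], fun r => .step _ _ r (fun i => Move.refl _) ?_⟩
  have hw : PairWins n (r.1 : ℤ) (r.2 : ℤ) (o.1 - r.1 : ℤ) (o.2 - r.2 : ℤ) (o.1 - r.1 : ℤ)
      (o.2 - r.2 : ℤ) :=
    PairWins.stack (by omega) (onBoard_val r) (by simpa using onBoard_val o)
  exact copsWinFrom_of_pairWins hconn _ hw r o o o rfl rfl (by ring) (by ring) (by ring)
    (by ring) le_rfl

/-! ### Connectedness -/

theorem reachable_of_knightNear {n : ℕ} {u v : Fin n × Fin n}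
    (h : KnightNear (squareVal u) (squareVal v)) : (knightGraph n).Reachable u v := by
  rcases (move_iff_knightNear u v).2 h with rfl | h
  exacts [SimpleGraph.Reachable.refl _, h.reachable]

/-- Neighbouring squares of a row are joined by three moves of a knight. -/
theorem knightGraph_reachable_succ {n : ℕ} (hn : 4 ≤ n) {x y : ℕ} (hx : x < n) (hx' : x + 1 < n)
    (hy : y < n) :
    (knightGraph n).Reachable (⟨x, hx⟩, ⟨y, hy⟩) (⟨x + 1, hx'⟩, ⟨y, hy⟩) := by
  have key : ∀ z w t : ℕ, ∀ (hz : z < n) (hw : w < n) (ht : t < n),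
      KnightNear (x, y) (x + 1, w) → KnightNear (x + 1, w) (z, t) →
      KnightNear (z, t) (x + 1, y) →
      (knightGraph n).Reachable (⟨x, hx⟩, ⟨y, hy⟩) (⟨x + 1, hx'⟩, ⟨y, hy⟩) := by
    intro z w t hz hw ht h1 h2 h3
    exact ((reachable_of_knightNear (u := (⟨x, hx⟩, ⟨y, hy⟩))
      (v := (⟨x + 1, hx'⟩, ⟨w, hw⟩)) h1).trans
      (reachable_of_knightNear (v := (⟨z, hz⟩, ⟨t, ht⟩)) h2)).trans (reachable_of_knightNear h3)
  -- The path runs through `(x + 1, y ± 2)` and `(z, y ± 1)`, where `z` is two away from `x + 1` on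
  -- a side that stays on the board; `x = 0` forces `z = 3`, hence `4 ≤ n`.
  have hz : ∃ z < n, z + 2 = x + 1 ∨ x + 1 + 2 = z := by
    rcases Nat.eq_zero_or_pos x with rfl | h
    · exact ⟨3, by omega⟩
    · exact ⟨x - 1, by omega⟩
  obtain ⟨z, hz, hzx⟩ := hz
  by_cases h : y + 2 < n
  · refine key z (y + 2) (y + 1) hz h (by omega) ?_ ?_ ?_ <;> unfold KnightNear <;>
      right <;> omega
  · refine key z (y - 2) (y - 1) hz (by omega) (by omega) ?_ ?_ ?_ <;> unfold KnightNear <;>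
      right <;> omega

/-- Reflection of the board in its diagonal. -/
def knightGraphSwap (n : ℕ) : knightGraph n →g knightGraph n where
  toFun := Prod.swap
  map_rel' h := h.elim (fun h => Or.inr h.symm) fun h => Or.inl h.symm

/-- Unit steps in the first coordinate bring every square to first coordinate zero; the diagonal
reflection of the same path then leads to the corner. -/
theorem knightGraph_connected {n : ℕ} (hn : 4 ≤ n) : (knightGraph n).Connected := by
  have hn0 : 0 < n := by omega
  have row : ∀ (y : Fin n) (x : ℕ) (hx : x < n),
      (knightGraph n).Reachable (⟨x, hx⟩, y) (⟨0, hn0⟩, y) := by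
    intro y x
    induction x with
    | zero => exact fun _ => SimpleGraph.Reachable.refl _
    | succ x ih =>
      exact fun hx =>
        (knightGraph_reachable_succ hn (Nat.lt_of_succ_lt hx) hx y.2).symm.trans (ih _)
  have all : ∀ u : Fin n × Fin n, (knightGraph n).Reachable u (⟨0, hn0⟩, ⟨0, hn0⟩) := fun u =>
    (row u.2 u.1 u.1.2).trans ((row ⟨0, hn0⟩ u.2 u.2.2).map (knightGraphSwap n))
  have : Nonempty (Fin n × Fin n) := ⟨(⟨0, hn0⟩, ⟨0, hn0⟩)⟩
  exact ⟨fun u v => (all u).trans (all v).symm⟩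

/-! ### Boards without edges, and the theorem -/

theorem not_isCopWin_zero {V : Type*} [Nonempty V] (G : SimpleGraph V) : ¬ IsCopWin G 0 :=
  not_isCopWin_of_invariant (fun _ _ => True) (fun _ => ⟨Classical.arbitrary V, trivial⟩)
    fun _ _ r _ _ => ⟨fun i => i.elim0, r, Move.refl r, trivial⟩

theorem copNumber_eq_one_of_subsingleton {V : Type*} [Nonempty V] [Subsingleton V]
    (G : SimpleGraph V) : copNumber G = 1 := by
  refine copNumber_eq ⟨fun _ => Classical.arbitrary V, fun r =>
    .captured _ _ 0 (Subsingleton.elim _ _)⟩ fun j hj => ?_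
  obtain rfl : j = 0 := by omega
  exact not_isCopWin_zero G

theorem not_knightGraph_adj_of_le_two {n : ℕ} (hn : n ≤ 2) (u v : Fin n × Fin n) :
    ¬ (knightGraph n).Adj u v := by
  obtain ⟨⟨a, ha⟩, ⟨b, hb⟩⟩ := u
  obtain ⟨⟨c, hc⟩, ⟨d, hd⟩⟩ := v
  simp only [knightGraph, abs_natCast_sub_eq_one, abs_natCast_sub_eq_two]
  omega

theorem subsingleton_connectedComponent_of_le_two {n : ℕ} (hn : n ≤ 2)
    (C : (knightGraph n).ConnectedComponent) : Subsingleton C := by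
  refine ⟨fun u v => Subtype.ext ?_⟩
  obtain ⟨p⟩ : (knightGraph n).Reachable u v :=
    SimpleGraph.ConnectedComponent.exact (u.2.trans v.2.symm)
  generalize u.1 = a at p ⊢
  generalize v.1 = b at p ⊢
  cases p with
  | nil => rfl
  | cons h _ => exact absurd h (not_knightGraph_adj_of_le_two hn _ _)

theorem theorem1p2 (n : ℕ) (hn : 1 ≤ n) :
    (n ≤ 2 → ∀ C : (knightGraph n).ConnectedComponent,
      CopsAndRobbers.copNumber C.toSimpleGraph = 1) ∧
    (4 ≤ n → (knightGraph n).Connected) ∧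
    (4 ≤ n ∧ n ≤ 6 → CopsAndRobbers.copNumber (knightGraph n) = 2) ∧
    (n = 3 ∨ 7 ≤ n → CopsAndRobbers.copNumber (knightGraph n) = 3) := by
  refine ⟨fun h C => ?_, knightGraph_connected, ?_, ?_⟩
  · have := subsingleton_connectedComponent_of_le_two h C
    have : Nonempty C := C.nonempty_supp.to_subtype
    exact copNumber_eq_one_of_subsingleton _
  · rintro ⟨h4, h6⟩
    refine copNumber_eq ?_ fun j hj =>
      not_isCopWin_knightGraph_of_le_one (by omega) (by omega)
    obtain rfl | rfl | rfl : n = 4 ∨ n = 5 ∨ n = 6 := by omega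
    exacts [isCopWin_two_knightGraph_four, isCopWin_two_knightGraph_five,
      isCopWin_two_knightGraph_six]
  · rintro (rfl | h7)
    · refine copNumber_eq isCopWin_three_knightGraph_three fun j hj => ?_
      obtain h | rfl : j ≤ 1 ∨ j = 2 := by omega
      exacts [not_isCopWin_knightGraph_of_le_one h le_rfl, not_isCopWin_knightGraph_three_two]
    · exact copNumber_eq (isCopWin_three_knightGraph h7 (knightGraph_connected (by omega)))
        fun j hj => not_isCopWin_knightGraph_of_le_two (by omega) h7
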